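/- Let $n\ge 3$ and let $f_1,\dots,f_n$ be contracting homeomorphisms of $\mathbb{R}^d$ with attractor $F$, i.e. $F$ is the unique nonempty compact set with $F=\bigcup_{k=1}^n f_k(F)$. Put $I=\{1,\dots,n\}$, $F_k=f_k(F)$ and $F_{kj}=f_k(f_j(F))$. Assume that $F$ is a necklace, i.e. for distinct $m,k\in I$ the set $F_m\cap F_k$ is a singleton if $|m-k|\in\{1,n-1\}$ and is empty if $2\le|m-k|\le n-2$, and that $F$ is not a single point. Let $z_k$ be the unique point of $F_k\cap F_{k+1}$ for $k\in I$ (the main nodes), where $F_{n+1}=F_1$ and $z_0=z_n$. The necklace is called good if $\#(F_{kj}\cap\partial_F F_k)\le 1$ for all $k,j\in I$, where $\partial_F$ is the boundary in the relative topology of $F$. For a connected space $X$, a set $A\subseteq X$ is a cut of $X$ if $X\setminus A$ is not connected but $X\setminus B$ is connected for every $B\subsetneq A$ (the empty set counts as connected); a $k$-cut is a cut with exactly $k$ points, and a cut point is a point $x$ such that $\{x\}$ is a cut. Let $\mathrm{ncp}(X)$ be the number of cut points of $X$, let $$N(A,X)=\sup\{\mathrm{ncp}(\overline{C}): C\text{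 a component of }X\setminus A\},\qquad N_k(X)=\sup\{N(A,X): A\text{ a }k\text{-cut of }X\},$$ with $\overline{C}$ the closure of $C$ in $X$, and call a $k$-cut $A$ of $X$ extremal if $N(A,X)=N_k(X)$. If $F$ has no cut points, then $N_2(F)=n-2$, and $\{z_{k-1},z_k\}$ is an extremal $2$-cut of $F$ for every $k\in I$. If moreover $F$ is good, then the pairs $\{z_{k-1},z_k\}$, $k\in I$, are the only extremal $2$-cuts of $F$. -/

import Mathlib

open Set

namespace Necklace

section Topology

variable {α : Type*} [TopologicalSpace α]

/-- Boundary of `A` in the relative topology of `X`, as a subset of the ambient space. -/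
def relFrontier (X A : Set α) : Set α :=
  Subtype.val '' frontier (Subtype.val ⁻¹' A : Set X)

/-- `A` is a cut of the subspace `X`: removing `A` disconnects `X`, and removing a proper
subset of `A` does not. The empty set counts as connected (`IsPreconnected`). -/
def IsCut (X A : Set α) : Prop :=
  A ⊆ X ∧ ¬ IsPreconnected (X \ A) ∧ ∀ B, B ⊂ A → IsPreconnected (X \ B)

/-- A cut with exactly `k` points. -/
def IsKCut (k : ℕ) (X A : Set α) : Prop :=
  IsCut X A ∧ A.encard = k

/-- `x` is a cut point of the subspace `X`. -/
def IsCutPoint (X : Set α) (x : α) : Prop :=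
  IsCut X {x}

/-- The number of cut points of the subspace `X`, in `ℕ ∪ {∞}`. -/
noncomputable def ncp (X : Set α) : ℕ∞ :=
  {x | IsCutPoint X x}.encard

/-- `C` is a connected component of the subspace `Y`. -/
def IsComponent (Y C : Set α) : Prop :=
  ∃ x ∈ Y, C = connectedComponentIn Y x

/-- `N(A, X)`: the supremum of `ncp` over the closures in `X` of the components of `X \ A`. -/
noncomputable def cutNumber (A X : Set α) : ℕ∞ :=
  ⨆ (C : Set α) (_ : IsComponent (X \ A) C), ncp (closure C ∩ X)

/-- `N_k(X)`: the supremum of `N(A, X)` over the `k`-cuts `A` of `X`. -/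
noncomputable def maxCutNumber (k : ℕ) (X : Set α) : ℕ∞ :=
  ⨆ (A : Set α) (_ : IsKCut k X A), cutNumber A X

/-- A `k`-cut `A` of `X` with `N(A, X) = N_k(X)`. -/
def IsExtremalKCut (k : ℕ) (X A : Set α) : Prop :=
  IsKCut k X A ∧ cutNumber A X = maxCutNumber k X

end Topology

section IFS

variable {α : Type*} [MetricSpace α] {n : ℕ}

/-- `F` is the attractor of the family `f`. -/
def IsAttractor (f : Fin n → α ≃ₜ α) (F : Set α) : Prop :=
  F.Nonempty ∧ IsCompact F ∧ F = ⋃ k, f k '' F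

/-- `F` is a necklace with the necklace iterated function system `f`. The indices `1, …, n`
are represented by `0, …, n - 1`. -/
structure IsNecklace (f : Fin n → α ≃ₜ α) (F : Set α) : Prop where
  three_le : 3 ≤ n
  contracting : ∀ k, ∃ c, ContractingWith c (f k)
  attractor : IsAttractor f F
  inter_singleton : ∀ m k : Fin n,
    (|(m : ℤ) - (k : ℤ)| = 1 ∨ |(m : ℤ) - (k : ℤ)| = (n : ℤ) - 1) →
      ∃ p, f m '' F ∩ f k '' F = {p}
  inter_empty : ∀ m k : Fin n,
    2 ≤ |(m : ℤ) - (k : ℤ)| → |(m : ℤ) - (k : ℤ)| ≤ (n : ℤ) - 2 →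
      f m '' F ∩ f k '' F = ∅

/-- `z k` is the unique common point of the copy `F_k` and the cyclically next one
(`finRotate n` is the cyclic successor `k ↦ k + 1` on `Fin n`). -/
def IsMainNodes (f : Fin n → α ≃ₜ α) (F : Set α) (z : Fin n → α) : Prop :=
  ∀ k, f k '' F ∩ f (finRotate n k) '' F = {z k}

/-- Every second-level copy `F_{kj}` contains at most one boundary point of `F_k`. -/
def IsGood (f : Fin n → α ≃ₜ α) (F : Set α) : Prop :=
  ∀ k j, ((f k '' (f j '' F)) ∩ relFrontier F (f k '' F)).encard ≤ 1

end IFS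

end Necklace

/-! Without cut points, `F` is a ring: its pieces are connected, locally connected, free of cut
points, and glued cyclically at `n` distinct nodes. A run of fewer than `n` consecutive pieces has
exactly its inner nodes as cut points. Hence the `n - 1` pieces other than `F_k` form the closure of
a component of `F \ {z_{k-1}, z_k}` with `n - 2` cut points.

For the upper bound let `C` be a component of `F \ {a, b}` (`IsRing.component_cases`). If no piece
contains both points, then either both are nodes and `closure C` is a run with at most `n - 3` cut
points, or `F \ {a, b}` is connected and `closure C = F` has none. If `a, b` lie in one piece `F_k`,
let `Q` be the union of the other pieces, an arc between the end nodes of `F_k`. Unless `closure C`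
is `Q` itself, either `C` is a component of `F_k \ {a, b}`, or `closure C = closure D ∪ Q` for such
a component `D` and `Q` adds no cut point, or `Q` joins two such components into a loop without cut
points. So the count is bounded by that of a component in `F_k`, which pulls back along `f_k` to a
component for a pair in `F` that is further apart by a fixed factor. As `F` is bounded this stops,
giving `n - 2` (`IsSelfSimilarRing.ncp_closure_le`).

If `F` is good, a cut inside a piece never attains the bound
(`IsSelfSimilarRing.eq_nodes_of_le_ncp`). By induction the pulled-back closure would be a run of `n
- 1` pieces. If `C` avoids the end nodes of `F_k`, both lie in the one remaining second-level piece,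
against goodness. If `Q` is attached, the end nodes lie in different second-level pieces, so `Q`
bridges some inner node and destroys a cut point. -/

namespace Necklace

/-! ### Connected components and relatively clopen sets -/

section Components

variable {α : Type*} [TopologicalSpace α]

/-- Connected components of relatively open subsets of `P` are relatively open in `P`. -/
def HasOpenComponents (P : Set α) : Prop :=
  ∀ U, IsOpen U → ∀ x, ∃ O, IsOpen O ∧ connectedComponentIn (P ∩ U) x = P ∩ O

theorem isCutPoint_iff {X : Set α} (hX : IsPreconnected X) {x : α} :
    IsCutPoint X x ↔ x ∈ X ∧ ¬ IsPreconnected (X \ {x}) := by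
  constructor
  · rintro ⟨h, h', -⟩
    exact ⟨h rfl, h'⟩
  · rintro ⟨h, h'⟩
    refine ⟨singleton_subset_iff.2 h, h', fun B hB => ?_⟩
    rw [ssubset_singleton_iff.1 hB]
    simpa using hX

theorem closure_connectedComponentIn_inter_subset (Y : Set α) (x : α) :
    closure (connectedComponentIn Y x) ∩ Y ⊆ connectedComponentIn Y x := by
  by_cases hx : x ∈ Y
  · exact (isPreconnected_connectedComponentIn.subset_closure
      (subset_inter subset_closure (connectedComponentIn_subset Y x))
      inter_subset_left).subset_connectedComponentIn
        ⟨subset_closure (mem_connectedComponentIn hx), hx⟩ inter_subset_right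
  · simp [connectedComponentIn_eq_empty hx]

/-- A nontrivial connected T1 set has no isolated points, so deleting finitely many points does not
change its closure. -/
theorem subset_closure_diff_finite [T1Space α] {X A : Set α} (hX : IsPreconnected X)
    (hnt : X.Nontrivial) (hA : A.Finite) : X ⊆ closure (X \ A) := by
  intro x hx
  rw [mem_closure_iff]
  intro O hO hxO
  have hU : O ∩ (A \ {x})ᶜ ∈ nhds x :=
    (hO.inter (hA.subset sdiff_subset).isClosed.isOpen_compl).mem_nhds ⟨hxO, fun h => h.2 rfl⟩
  obtain ⟨y, ⟨⟨hyO, hyA⟩, hyX⟩, hyx⟩ :=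
    preperfect_iff_nhds.1 (hX.preperfect_of_nontrivial hnt) x hx _ hU
  exact ⟨y, hyO, hyX, fun h => hyA ⟨h, hyx⟩⟩

theorem eq_of_relatively_clopen {Y T O : Set α} (hY : IsPreconnected Y) (hO : IsOpen O)
    (hT : T = Y ∩ O) (hcl : closure T ∩ Y ⊆ T) (hne : T.Nonempty) : T = Y := by
  have hTY : T ⊆ Y := hT ▸ inter_subset_left
  refine hTY.antisymm fun y hy => ?_
  by_contra hyT
  obtain ⟨x, hx⟩ := hne
  have hxO : x ∈ Y ∩ O := hT ▸ hx
  obtain ⟨w, hwY, hwO, hwT⟩ := hY O (closure T)ᶜ hO isClosed_closure.isOpen_compl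
    (fun w hw => by
      by_cases h : w ∈ closure T
      · have : w ∈ Y ∩ O := hT ▸ hcl ⟨h, hw⟩
        exact Or.inl this.2
      · exact Or.inr h) ⟨x, hxO⟩ ⟨y, hy, fun h => hyT (hcl ⟨h, hy⟩)⟩
  exact hwT (subset_closure (hT ▸ ⟨hwY, hwO⟩))

theorem IsComponent.isPreconnected {Y C : Set α} (h : IsComponent Y C) : IsPreconnected C := by
  obtain ⟨x, -, rfl⟩ := h
  exact isPreconnected_connectedComponentIn

theorem IsComponent.nonempty {Y C : Set α} (h : IsComponent Y C) : C.Nonempty := by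
  obtain ⟨x, hx, rfl⟩ := h
  exact ⟨x, mem_connectedComponentIn hx⟩

theorem IsComponent.subset {Y C : Set α} (h : IsComponent Y C) : C ⊆ Y := by
  obtain ⟨x, -, rfl⟩ := h
  exact connectedComponentIn_subset Y x

theorem IsComponent.subset_of_inter {Y C T : Set α} (h : IsComponent Y C)
    (hT : IsPreconnected T) (hTY : T ⊆ Y) (hne : (T ∩ C).Nonempty) : T ⊆ C := by
  obtain ⟨x, -, rfl⟩ := h
  obtain ⟨y, hyT, hyC⟩ := hne
  rw [connectedComponentIn_eq hyC]
  exact hT.subset_connectedComponentIn hyT hTY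

theorem IsComponent.closure_inter_subset {Y C : Set α} (h : IsComponent Y C) :
    closure C ∩ Y ⊆ C := by
  obtain ⟨x, -, rfl⟩ := h
  exact closure_connectedComponentIn_inter_subset Y x

/-- A component of a larger set that is contained in a smaller one is a component of it. -/
theorem IsComponent.mono {Y Z C : Set α} (h : IsComponent Y C) (hZY : Z ⊆ Y) (hC : C ⊆ Z) :
    IsComponent Z C := by
  obtain ⟨x, hx⟩ := h.nonempty
  refine ⟨x, hC hx, Subset.antisymm (h.isPreconnected.subset_connectedComponentIn hx hC) ?_⟩
  exact h.subset_of_inter isPreconnected_connectedComponentIn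
    ((connectedComponentIn_subset Z x).trans hZY) ⟨x, mem_connectedComponentIn (hC hx), hx⟩

theorem IsComponent.eq_of_isPreconnected {Y C : Set α} (h : IsComponent Y C)
    (hY : IsPreconnected Y) : C = Y := by
  obtain ⟨x, hx⟩ := h.nonempty
  exact h.subset.antisymm (h.subset_of_inter hY Subset.rfl ⟨x, h.subset hx, hx⟩)

/-- Removing from `P ∪ Q` a set that contains `P ∩ Q` separates `P` from `Q`. -/
theorem IsComponent.eq_or_of_inter_subset {P Q A C : Set α} (hP : IsClosed P) (hQ : IsClosed Q)
    (hPQ : P ∩ Q ⊆ A) (hQA : IsPreconnected (Q \ A)) (hC : IsComponent ((P ∪ Q) \ A) C) :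
    C = Q \ A ∨ IsComponent (P \ A) C ∧ Disjoint C Q := by
  have hsub : C ⊆ P ∪ Q := hC.subset.trans sdiff_subset
  have key : ¬ ((C ∩ P).Nonempty ∧ (C ∩ Q).Nonempty) := by
    rintro ⟨h1, h2⟩
    obtain ⟨x, hxC, hx⟩ := isPreconnected_closed_iff.1 hC.isPreconnected P Q hP hQ hsub h1 h2
    exact (hC.subset hxC).2 (hPQ hx)
  by_cases h : (C ∩ Q).Nonempty
  · left
    have hCQ : C ⊆ Q \ A := fun x hx => ⟨(hsub hx).resolve_left fun hxP => key ⟨⟨x, hx, hxP⟩, h⟩,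
      (hC.subset hx).2⟩
    obtain ⟨x, hxC, hxQ⟩ := h
    exact hCQ.antisymm (hC.subset_of_inter hQA (sdiff_subset_sdiff_left subset_union_right)
      ⟨x, hCQ hxC, hxC⟩)
  · right
    have hd : Disjoint C Q := disjoint_iff_inter_eq_empty.2 (not_nonempty_iff_eq_empty.1 h)
    refine ⟨hC.mono (sdiff_subset_sdiff_left subset_union_left) fun x hx => ⟨?_, (hC.subset hx).2⟩, hd⟩
    exact (hsub hx).resolve_right (disjoint_left.1 hd hx)

theorem IsComponent.closure_subset_union {P A D : Set α} (hPc : IsClosed P)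
    (hD : IsComponent (P \ A) D) : closure D ⊆ D ∪ A := by
  intro x hx
  by_cases hxA : x ∈ A
  · exact Or.inr hxA
  · exact Or.inl (hD.closure_inter_subset
      ⟨hx, closure_minimal (hD.subset.trans sdiff_subset) hPc hx, hxA⟩)

theorem IsComponent.isPreconnected_closure_diff {Y D : Set α} {x : α} (hD : IsComponent Y D)
    (hx : x ∉ D) : IsPreconnected (closure D \ {x}) :=
  hD.isPreconnected.subset_closure (fun _ h => ⟨subset_closure h, fun h' => hx (h' ▸ h)⟩)
    sdiff_subset

end Components

/-! ### Complement of a pair of points in a set without cut points -/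

section Pair

variable {α : Type*} [TopologicalSpace α] [T1Space α]

theorem HasOpenComponents.diff_finite {P : Set α} (hP : HasOpenComponents P) {A : Set α}
    (hA : A.Finite) (x : α) : ∃ O, IsOpen O ∧ connectedComponentIn (P \ A) x = P ∩ O :=
  hP Aᶜ hA.isClosed.isOpen_compl x

theorem IsComponent.exists_isOpen {P A D : Set α} (hP : HasOpenComponents P) (hA : A.Finite)
    (hD : IsComponent (P \ A) D) : ∃ O, IsOpen O ∧ D = P ∩ O := by
  obtain ⟨x, -, rfl⟩ := hD
  exact hP.diff_finite hA x

/-- If `a` were not in the closure, `D` would be clopen in the connected set `P \ {b}`, hence all of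
it, although `a ∈ P \ {b}` is not in `D`. -/
theorem IsComponent.left_mem_closure {P D : Set α} {a b : α} (hPc : IsClosed P)
    (hPo : HasOpenComponents P) (hP : ∀ x, IsPreconnected (P \ {x})) (ha : a ∈ P) (hab : a ≠ b)
    (hD : IsComponent (P \ {a, b}) D) : a ∈ closure D := by
  by_contra haD
  obtain ⟨O, hO, hDO⟩ := hD.exists_isOpen hPo (by simp)
  have hDb : b ∉ D := fun h => (hD.subset h).2 (by simp)
  have hDa : a ∉ D := fun h => (hD.subset h).2 (by simp)
  have : D = P \ {b} := by
    refine eq_of_relatively_clopen (hP b) hO ?_ ?_ hD.nonempty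
    · ext x
      constructor
      · intro h
        exact ⟨⟨(hDO ▸ h : x ∈ P ∩ O).1, fun hx => hDb (hx ▸ h)⟩, (hDO ▸ h : x ∈ P ∩ O).2⟩
      · intro h
        rw [hDO]
        exact ⟨h.1.1, h.2⟩
    · rintro x ⟨hx, -, hxb⟩
      rcases hD.closure_subset_union hPc hx with h | rfl | h
      · exact h
      · exact absurd hx haD
      · exact absurd h hxb
  exact hDa (this ▸ ⟨ha, hab⟩)

theorem IsComponent.closure_eq_union_pair {P D : Set α} {a b : α} (hPc : IsClosed P)
    (hPo : HasOpenComponents P) (hP : ∀ x, IsPreconnected (P \ {x})) (ha : a ∈ P) (hb : b ∈ P)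
    (hab : a ≠ b) (hD : IsComponent (P \ {a, b}) D) : closure D = D ∪ {a, b} := by
  refine (hD.closure_subset_union hPc).antisymm (union_subset subset_closure ?_)
  rintro x (rfl | rfl)
  · exact hD.left_mem_closure hPc hPo hP ha hab
  · rw [pair_comm] at hD
    exact hD.left_mem_closure hPc hPo hP hb hab.symm

/-- Removing one point from the closure of a component of the complement of a pair, every other
point stays connected to one of the points of the pair. -/
theorem IsComponent.exists_isPreconnected_mem {P D : Set α} {a b x y : α} (hPc : IsClosed P)
    (hPo : HasOpenComponents P) (hP : ∀ x, IsPreconnected (P \ {x})) (ha : a ∈ P)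
    (hD : IsComponent (P \ {a, b}) D) (hx : x ∈ D) (hy : y ∈ closure D) (hyx : y ≠ x) :
    ∃ T ⊆ closure D \ {x}, IsPreconnected T ∧ y ∈ T ∧ (a ∈ T ∨ b ∈ T) := by
  have hDP : closure D ⊆ P := closure_minimal (hD.subset.trans sdiff_subset) hPc
  refine ⟨connectedComponentIn (closure D \ {x}) y, connectedComponentIn_subset _ _,
    isPreconnected_connectedComponentIn, mem_connectedComponentIn ⟨hy, hyx⟩, ?_⟩
  set T := connectedComponentIn (closure D \ {x}) y with hT
  have hyT : y ∈ T := mem_connectedComponentIn ⟨hy, hyx⟩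
  -- If `T` misses both `a` and `b`, it lies in `D \ {x}` and is clopen in the connected set `P \
  -- {x}`. Then it equals `P \ {x}`, which contains `a`.
  by_contra! hab
  have hTsub : T ⊆ closure D \ {x} := connectedComponentIn_subset _ _
  have hTD : T ⊆ D \ {x} := fun w hw => ⟨by
    rcases hD.closure_subset_union hPc (hTsub hw).1 with h | rfl | rfl
    exacts [h, absurd hw hab.1, absurd hw hab.2], (hTsub hw).2⟩
  obtain ⟨O, hO, hDO⟩ := hD.exists_isOpen hPo (by simp)
  obtain ⟨O', hO', hTO'⟩ := hPo (O \ {x}) (hO.sdiff isClosed_singleton) y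
  have hDx : P ∩ (O \ {x}) = D \ {x} := by rw [hDO, inter_sdiff_assoc]
  have hT2 : T = P ∩ O' := by
    rw [← hTO', hDx]
    exact Subset.antisymm
      (isPreconnected_connectedComponentIn.subset_connectedComponentIn hyT hTD)
      (connectedComponentIn_mono y (sdiff_subset_sdiff_left subset_closure))
  have hxT : x ∉ T := fun h => (hTD h).2 rfl
  have : T = P \ {x} := by
    refine eq_of_relatively_clopen (hP x) hO' ?_ ?_ ⟨y, hyT⟩
    · ext w
      constructor
      · intro h
        have h' : w ∈ P ∩ O' := hT2 ▸ h
        exact ⟨⟨h'.1, (hTD h).2⟩, h'.2⟩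
      · intro h
        rw [hT2]
        exact ⟨h.1.1, h.2⟩
    · rintro w ⟨hw, -, hwx⟩
      exact closure_connectedComponentIn_inter_subset _ _
        ⟨hw, closure_minimal (hTD.trans (sdiff_subset.trans subset_closure)) isClosed_closure hw, hwx⟩
  refine hab.1 (this ▸ ⟨ha, ?_⟩)
  rintro rfl
  exact (hD.subset hx).2 (by simp)

end Pair

/-! ### Attaching an arc-like set at two points -/

section Link

variable {α : Type*} [TopologicalSpace α]

/-- `Q` is a closed set joining `u` to `v` that no removal of end points disconnects and in which
every point stays connected to an end point when another point is removed. -/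
structure IsLink (Q : Set α) (u v : α) : Prop where
  isClosed : IsClosed Q
  ne : u ≠ v
  left_mem : u ∈ Q
  right_mem : v ∈ Q
  isPreconnected_diff : ∀ S : Set α, S ∩ Q ⊆ {u, v} → IsPreconnected (Q \ S)
  exists_mem : ∀ x ∈ Q, x ≠ u → x ≠ v → ∀ y ∈ Q, y ≠ x →
    ∃ T ⊆ Q \ {x}, IsPreconnected T ∧ y ∈ T ∧ (u ∈ T ∨ v ∈ T)

theorem IsLink.symm {Q : Set α} {u v : α} (h : IsLink Q u v) : IsLink Q v u where
  isClosed := h.isClosed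
  ne := h.ne.symm
  left_mem := h.right_mem
  right_mem := h.left_mem
  isPreconnected_diff S hS := h.isPreconnected_diff S (by rwa [pair_comm])
  exists_mem x hx hu hv y hy hyx := by
    obtain ⟨T, h1, h2, h3, h4⟩ := h.exists_mem x hx hv hu y hy hyx
    exact ⟨T, h1, h2, h3, h4.symm⟩

theorem IsLink.isPreconnected {Q : Set α} {u v : α} (h : IsLink Q u v) : IsPreconnected Q := by
  simpa using h.isPreconnected_diff ∅ (by simp)

theorem IsLink.isPreconnected_diff_of_mem {P Q : Set α} {u v x : α} (h : IsLink Q u v)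
    (hPQ : P ∩ Q ⊆ {u, v}) (hx : x ∈ P) : IsPreconnected (Q \ {x}) :=
  h.isPreconnected_diff _ (by rintro y ⟨rfl, hy⟩; exact hPQ ⟨hx, hy⟩)

/-- Gluing a link to a connected set containing its end points creates no cut points. -/
theorem IsLink.isPreconnected_union_diff {Q D : Set α} {u v x : α} (h : IsLink Q u v)
    (hD : IsPreconnected (D \ {x})) (hu : u ∈ D) (hv : v ∈ D)
    (hxQ : x ∈ D → x ∈ Q → x = u ∨ x = v) : IsPreconnected ((D ∪ Q) \ {x}) := by
  by_cases hx : x ∈ Q → x = u ∨ x = v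
  · have hQx : IsPreconnected (Q \ {x}) := h.isPreconnected_diff _ (by
      rintro y ⟨rfl, hy⟩; exact hx hy)
    rw [union_sdiff_distrib]
    refine hD.union' ?_ hQx
    by_cases hxu : u = x
    · exact ⟨v, ⟨hv, fun h' => h.ne (hxu.trans h'.symm)⟩,
        h.right_mem, fun h' => h.ne (hxu.trans h'.symm)⟩
    · exact ⟨u, ⟨hu, hxu⟩, h.left_mem, hxu⟩
  -- Here `x` is an inner point of `Q`, so it is not in `D`. Thus `D` stays whole and every
  -- remaining point of `Q` is tied to it through `u` or `v`.
  · push Not at hx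
    obtain ⟨hxQ', hxu, hxv⟩ := hx
    have hxD : x ∉ D := fun h' => by rcases hxQ h' hxQ' with h'' | h'' <;> contradiction
    refine isPreconnected_of_forall u ?_
    rintro y ⟨hy | hy, hyx⟩
    · exact ⟨D \ {x}, sdiff_subset_sdiff_left subset_union_left, ⟨hu, hxu.symm⟩, ⟨hy, hyx⟩, hD⟩
    · obtain ⟨T, hT, hTp, hyT, hTuv⟩ := h.exists_mem x hxQ' hxu hxv y hy hyx
      refine ⟨D \ {x} ∪ T, union_subset (sdiff_subset_sdiff_left subset_union_left)
        (hT.trans (sdiff_subset_sdiff_left subset_union_right)), Or.inl ⟨hu, hxu.symm⟩,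
        Or.inr hyT, hD.union' ?_ hTp⟩
      rcases hTuv with h' | h'
      · exact ⟨u, ⟨hu, hxu.symm⟩, h'⟩
      · exact ⟨v, ⟨hv, hxv.symm⟩, h'⟩

variable [T1Space α]

/-- `A` meets `Q` only in end points, so `Q \ A` is connected, and it touches the rest of `P \ A`
only at `u` and `v`. If an end point lies in `A`, its `connectedComponentIn` is empty by convention,
so one formula covers all cases. -/
theorem IsLink.component_eq {P Q A C : Set α} {u v : α} (hQ : IsLink Q u v) (hPc : IsClosed P)
    (hPo : HasOpenComponents P) (hPQ : P ∩ Q = {u, v}) (hA : A.Finite) (hAP : A ⊆ P)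
    (hC : IsComponent ((P ∪ Q) \ A) C) (hCQ : (C ∩ Q).Nonempty) :
    C = connectedComponentIn (P \ A) u ∪ connectedComponentIn (P \ A) v ∪ Q \ A := by
  set Du := connectedComponentIn (P \ A) u with hDu
  set Dv := connectedComponentIn (P \ A) v with hDv
  have hu : u ∈ P := (hPQ.symm ▸ mem_insert u {v} : u ∈ P ∩ Q).1
  have hv : v ∈ P := (hPQ.symm ▸ mem_insert_of_mem u rfl : v ∈ P ∩ Q).1
  have hPA : P \ A ⊆ (P ∪ Q) \ A := sdiff_subset_sdiff_left subset_union_left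
  have hQA : Q \ A ⊆ C := by
    refine hC.subset_of_inter (hQ.isPreconnected_diff A ?_)
      (sdiff_subset_sdiff_left subset_union_right) ?_
    · rw [← hPQ]
      exact inter_subset_inter_left Q hAP
    · obtain ⟨x, hxC, hxQ⟩ := hCQ
      exact ⟨x, ⟨hxQ, (hC.subset hxC).2⟩, hxC⟩
  have hsub : ∀ w ∈ Q, connectedComponentIn (P \ A) w ⊆ C := by
    intro w hwQ
    by_cases hw : w ∈ P \ A
    · exact hC.subset_of_inter isPreconnected_connectedComponentIn
        ((connectedComponentIn_subset _ _).trans hPA)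
        ⟨w, mem_connectedComponentIn hw, hQA ⟨hwQ, hw.2⟩⟩
    · simp [connectedComponentIn_eq_empty hw]
  refine Subset.antisymm ?_
    (union_subset (union_subset (hsub u hQ.left_mem) (hsub v hQ.right_mem)) hQA)
  obtain ⟨O, hO, hDO⟩ := hPo.diff_finite hA u
  obtain ⟨O', hO', hDO'⟩ := hPo.diff_finite hA v
  have hmem : ∀ w ∈ Q, w ∈ P \ A → w ∈ O ∪ O' := by
    intro w hwQ hw
    rcases (hPQ ▸ ⟨hw.1, hwQ⟩ : w ∈ ({u, v} : Set α)) with rfl | rfl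
    · exact Or.inl (hDO ▸ mem_connectedComponentIn hw : w ∈ P ∩ O).2
    · exact Or.inr (hDO' ▸ mem_connectedComponentIn hw : w ∈ P ∩ O').2
  have hcl : ∀ w, w ∈ closure Du ∪ closure Dv → w ∈ P \ A → w ∈ Du ∪ Dv := by
    rintro w (h | h) hw
    · exact Or.inl (closure_connectedComponentIn_inter_subset _ _ ⟨h, hw⟩)
    · exact Or.inr (closure_connectedComponentIn_inter_subset _ _ ⟨h, hw⟩)
  have hDsub : ∀ w, w ∈ Du ∪ Dv → w ∈ O ∪ O' := by
    rintro w (h | h)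
    · exact Or.inl (hDO ▸ h : w ∈ P ∩ O).2
    · exact Or.inr (hDO' ▸ h : w ∈ P ∩ O').2
  have hZ : IsClosed (closure Du ∪ closure Dv ∪ Q) :=
    (isClosed_closure.union isClosed_closure).union hQ.isClosed
  have hZ' : IsClosed (P \ (O ∪ O')) := hPc.sdiff (hO.union hO')
  have hcover : ∀ w ∈ C, w ∈ Du ∪ Dv ∪ Q ∨ w ∈ P \ (O ∪ O') := by
    intro w hw
    rcases (hC.subset hw).1 with hwP | hwQ
    · by_cases hwO : w ∈ O ∪ O'
      · left; left
        rcases hwO with h | h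
        · exact Or.inl (hDO.symm.subset ⟨hwP, h⟩)
        · exact Or.inr (hDO'.symm.subset ⟨hwP, h⟩)
      · exact Or.inr ⟨hwP, hwO⟩
    · exact Or.inl (Or.inr hwQ)
  have hclsub : Du ∪ Dv ∪ Q ⊆ closure Du ∪ closure Dv ∪ Q :=
    union_subset_union_left Q (union_subset_union subset_closure subset_closure)
  intro w hw
  rcases hcover w hw with h | h
  · rcases h with h | h
    · exact Or.inl h
    · exact Or.inr ⟨h, (hC.subset hw).2⟩
  -- The closed sets `closure Du ∪ closure Dv ∪ Q` and `P \ (O ∪ O')` cover `C`, both meet it, and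
  -- they have no common point outside `A`.
  · exfalso
    obtain ⟨x, hxC, hxQ⟩ := hCQ
    obtain ⟨y, hyC, hy, hyP, hyO⟩ := isPreconnected_closed_iff.1 hC.isPreconnected _ _ hZ hZ'
      (fun y hy => (hcover y hy).imp_left fun h' => hclsub h') ⟨x, hxC, Or.inr hxQ⟩ ⟨w, hw, h⟩
    have hyA : y ∉ A := (hC.subset hyC).2
    rcases hy with hy | hy
    · exact hyO (hDsub y (hcl y hy ⟨hyP, hyA⟩))
    · exact hyO (hmem y hy ⟨hyP, hyA⟩)

/-- Two components that meet a link at its two different ends close up to a set without cut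
points. -/
theorem IsLink.isPreconnected_closure_union_diff {P Q D E : Set α} {u v a b : α} (hQ : IsLink Q u v)
    (hPc : IsClosed P) (hPo : HasOpenComponents P) (hP : ∀ x, IsPreconnected (P \ {x}))
    (hPQ : P ∩ Q = {u, v}) (ha : a ∈ P) (hb : b ∈ P) (hab : a ≠ b)
    (hD : IsComponent (P \ {a, b}) D) (hE : IsComponent (P \ {a, b}) E) (hu : u ∈ D) (hv : v ∈ E)
    (hDE : Disjoint D E) (x : α) : IsPreconnected ((closure D ∪ closure E ∪ Q) \ {x}) := by
  have hcD := hD.closure_eq_union_pair hPc hPo hP ha hb hab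
  have hcE := hE.closure_eq_union_pair hPc hPo hP ha hb hab
  have haD : a ∈ closure D := hcD ▸ (by simp)
  have haE : a ∈ closure E := hcE ▸ (by simp)
  have hbE : b ∈ closure E := hcE ▸ (by simp)
  have hDP : closure D ⊆ P := closure_minimal (hD.subset.trans sdiff_subset) hPc
  have hEP : closure E ⊆ P := closure_minimal (hE.subset.trans sdiff_subset) hPc
  -- `D` and `E` are disjoint, so `x` misses one of them, and the configuration is symmetric.
  wlog hxE : x ∉ E generalizing D E u v
  · rw [union_comm (closure D)]
    have hxE' : x ∈ E := not_not.1 hxE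
    exact this hQ.symm (by rw [hPQ, pair_comm]) hE hD hv hu hDE.symm hcE hcD haE haD
      (hcD ▸ (by simp)) hEP hDP (disjoint_right.1 hDE hxE')
  have hEx : IsPreconnected (closure E \ {x}) := hE.isPreconnected_closure_diff hxE
  have hvx : v ≠ x := by rintro rfl; exact hxE hv
  -- If `x ∈ D`, then `closure E ∪ Q` remains connected, and each remaining point of `closure D`
  -- reaches it through `a` or `b`. These are the two ways round the loop.
  by_cases hxD : x ∈ D
  · have hQx := hQ.isPreconnected_diff_of_mem hPQ.subset (hDP (subset_closure hxD))
    have hM : IsPreconnected (closure E \ {x} ∪ Q \ {x}) :=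
      hEx.union' ⟨v, ⟨subset_closure hv, hvx⟩, hQ.right_mem, hvx⟩ hQx
    have hMs : closure E \ {x} ∪ Q \ {x} ⊆ (closure D ∪ closure E ∪ Q) \ {x} :=
      union_subset (sdiff_subset_sdiff_left fun y hy => Or.inl (Or.inr hy))
        (sdiff_subset_sdiff_left subset_union_right)
    refine isPreconnected_of_forall v ?_
    rintro y ⟨(hy | hy) | hy, hyx⟩
    · obtain ⟨T, hT, hTp, hyT, hTab⟩ :=
        hD.exists_isPreconnected_mem hPc hPo hP ha hxD hy hyx
      refine ⟨(closure E \ {x} ∪ Q \ {x}) ∪ T, union_subset hMs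
        (hT.trans (sdiff_subset_sdiff_left fun y hy => Or.inl (Or.inl hy))),
        Or.inl (Or.inl ⟨subset_closure hv, hvx⟩), Or.inr hyT, hM.union' ?_ hTp⟩
      rcases hTab with h | h
      · exact ⟨a, Or.inl ⟨haE, (hT h).2⟩, h⟩
      · exact ⟨b, Or.inl ⟨hbE, (hT h).2⟩, h⟩
    · exact ⟨_, hMs, Or.inl ⟨subset_closure hv, hvx⟩, Or.inl ⟨hy, hyx⟩, hM⟩
    · exact ⟨_, hMs, Or.inl ⟨subset_closure hv, hvx⟩, Or.inr ⟨hy, hyx⟩, hM⟩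
  · have hDx : IsPreconnected (closure D \ {x}) := hD.isPreconnected_closure_diff hxD
    have hux : u ≠ x := by rintro rfl; exact hxD hu
    by_cases hxP : x ∈ P
    · have hQx := hQ.isPreconnected_diff_of_mem hPQ.subset hxP
      rw [union_sdiff_distrib, union_sdiff_distrib, union_assoc]
      exact hDx.union' ⟨u, ⟨subset_closure hu, hux⟩, Or.inr ⟨hQ.left_mem, hux⟩⟩
        (hEx.union' ⟨v, ⟨subset_closure hv, hvx⟩, hQ.right_mem, hvx⟩ hQx)
    · refine hQ.isPreconnected_union_diff ?_ (Or.inl (subset_closure hu))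
        (Or.inr (subset_closure hv)) fun h _ => absurd (union_subset hDP hEP h) hxP
      rw [union_sdiff_distrib]
      have hax : a ≠ x := by rintro rfl; exact hxP ha
      exact hDx.union' ⟨a, ⟨haD, hax⟩, haE, hax⟩ hEx

/-- The closure of a component of the complement of a pair of points of `P` in the union of `P`
with a link. -/
theorem IsLink.component_cases {P Q C : Set α} {u v a b : α} (hQ : IsLink Q u v)
    (hPc : IsClosed P) (hPo : HasOpenComponents P) (hP : ∀ x, IsPreconnected (P \ {x}))
    (hPQ : P ∩ Q = {u, v}) (ha : a ∈ P) (hb : b ∈ P) (hab : a ≠ b)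
    (huv : ({a, b} : Set α) ≠ {u, v}) (hC : IsComponent ((P ∪ Q) \ {a, b}) C) :
    (IsComponent (P \ {a, b}) C ∧ u ∉ C ∧ v ∉ C) ∨
    (∃ D, IsComponent (P \ {a, b}) D ∧ u ∈ closure D ∧ v ∈ closure D ∧
      closure C = closure D ∪ Q ∧ ∀ x, IsCutPoint (closure C) x → IsCutPoint (closure D) x) ∨
    ∀ x, ¬ IsCutPoint (closure C) x := by
  have hAP : ({a, b} : Set α) ⊆ P := by rintro x (rfl | rfl) <;> assumption
  have hA : ({a, b} : Set α).Finite := by simp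
  have hu : u ∈ P := (hPQ.symm ▸ mem_insert u {v} : u ∈ P ∩ Q).1
  have hv : v ∈ P := (hPQ.symm ▸ mem_insert_of_mem u rfl : v ∈ P ∩ Q).1
  by_cases hCQ : (C ∩ Q).Nonempty
  swap
  · left
    have hd : ∀ x ∈ C, x ∉ Q := fun x hx hxQ => hCQ ⟨x, hx, hxQ⟩
    refine ⟨hC.mono (sdiff_subset_sdiff_left subset_union_left) fun x hx =>
      ⟨(hC.subset hx).1.resolve_right (hd x hx), (hC.subset hx).2⟩,
      fun h => hd u h hQ.left_mem, fun h => hd v h hQ.right_mem⟩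
  right
  have hCeq := hQ.component_eq hPc hPo hPQ hA hAP hC hCQ
  have hQcl : closure (Q \ {a, b}) = Q :=
    (closure_minimal sdiff_subset hQ.isClosed).antisymm
      (subset_closure_diff_finite hQ.isPreconnected ⟨u, hQ.left_mem, v, hQ.right_mem, hQ.ne⟩ hA)
  have hclC : closure C = closure (connectedComponentIn (P \ {a, b}) u) ∪
      closure (connectedComponentIn (P \ {a, b}) v) ∪ Q := by
    rw [hCeq, closure_union, closure_union, hQcl]
  have hCp : IsPreconnected (closure C) := hC.isPreconnected.closure
  -- Case of one component `D` whose closure holds both ends of the link. An end in `{a, b}`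
  -- qualifies because `closure D = D ∪ {a, b}`.
  have single : ∀ D, IsComponent (P \ {a, b}) D → (u ∈ D ∪ {a, b}) → (v ∈ D ∪ {a, b}) →
      closure C = closure D ∪ Q → ∃ D, IsComponent (P \ {a, b}) D ∧ u ∈ closure D ∧ v ∈ closure D ∧
      closure C = closure D ∪ Q ∧ ∀ x, IsCutPoint (closure C) x → IsCutPoint (closure D) x := by
    intro D hD hu' hv' hcl
    have hcD := hD.closure_eq_union_pair hPc hPo hP ha hb hab
    rw [← hcD] at hu' hv'
    refine ⟨D, hD, hu', hv', hcl, fun x hx => ?_⟩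
    have hDP : closure D ⊆ P := closure_minimal (hD.subset.trans sdiff_subset) hPc
    rw [isCutPoint_iff hCp, hcl] at hx
    rw [isCutPoint_iff hD.isPreconnected.closure]
    have hnot : ¬ IsPreconnected (closure D \ {x}) := fun h =>
      hx.2 (hQ.isPreconnected_union_diff h hu' hv' fun h1 h2 => hPQ.subset ⟨hDP h1, h2⟩)
    refine ⟨by_contra fun hxD => hnot ?_, hnot⟩
    rw [sdiff_singleton_eq_self hxD]
    exact hD.isPreconnected.closure
  by_cases hua : u ∈ ({a, b} : Set α)
  · have hva : v ∉ ({a, b} : Set α) := by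
      intro hva
      apply huv
      have := hQ.ne
      rcases hua with rfl | rfl <;> rcases hva with rfl | rfl
      · exact absurd rfl this
      · rfl
      · exact pair_comm _ _
      · exact absurd rfl this
    left
    refine single _ ⟨v, ⟨hv, hva⟩, rfl⟩ (Or.inr hua) (Or.inl (mem_connectedComponentIn ⟨hv, hva⟩)) ?_
    rw [hclC, connectedComponentIn_eq_empty (x := u) fun h => h.2 hua]
    simp
  by_cases hva : v ∈ ({a, b} : Set α)
  · left
    refine single _ ⟨u, ⟨hu, hua⟩, rfl⟩ (Or.inl (mem_connectedComponentIn ⟨hu, hua⟩)) (Or.inr hva) ?_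
    rw [hclC, connectedComponentIn_eq_empty (x := v) fun h => h.2 hva]
    simp
  have huD := mem_connectedComponentIn (F := P \ {a, b}) ⟨hu, hua⟩
  have hvD := mem_connectedComponentIn (F := P \ {a, b}) ⟨hv, hva⟩
  by_cases hdisj : Disjoint (connectedComponentIn (P \ {a, b}) u)
      (connectedComponentIn (P \ {a, b}) v)
  · right
    intro x hx
    rw [isCutPoint_iff hCp, hclC] at hx
    exact hx.2 (hQ.isPreconnected_closure_union_diff hPc hPo hP hPQ ha hb hab ⟨u, ⟨hu, hua⟩, rfl⟩
      ⟨v, ⟨hv, hva⟩, rfl⟩ huD hvD hdisj x)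
  · left
    obtain ⟨w, hwu, hwv⟩ := not_disjoint_iff.1 hdisj
    have heq := (connectedComponentIn_eq hwu).trans (connectedComponentIn_eq hwv).symm
    refine single _ ⟨u, ⟨hu, hua⟩, rfl⟩ (Or.inl huD) (Or.inl (heq ▸ hvD)) ?_
    rw [hclC, ← heq, union_self]

end Link

/-! ### Runs of consecutive pieces -/

section Chain

variable {α : Type*}

/-- The union of the sets `K j` with `s ≤ j < t`. -/
def chain (K : ℕ → Set α) (s t : ℕ) : Set α := ⋃ j ∈ Ico s t, K j

theorem mem_chain {K : ℕ → Set α} {s t : ℕ} {x : α} :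
    x ∈ chain K s t ↔ ∃ j, s ≤ j ∧ j < t ∧ x ∈ K j := by
  simp [chain, and_assoc]

theorem chain_succ_self (K : ℕ → Set α) (s : ℕ) : chain K s (s + 1) = K s := by
  ext x
  rw [mem_chain]
  constructor
  · rintro ⟨j, h1, h2, h⟩
    obtain rfl : j = s := by lia
    exact h
  · exact fun h => ⟨s, le_rfl, by lia, h⟩

theorem chain_union_chain (K : ℕ → Set α) {s t r : ℕ} (hst : s ≤ t) (htr : t ≤ r) :
    chain K s t ∪ chain K t r = chain K s r := by
  rw [chain, chain, chain, ← Ico_union_Ico_eq_Ico hst htr, biUnion_union]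

theorem subset_chain (K : ℕ → Set α) {s t j : ℕ} (hs : s ≤ j) (ht : j < t) :
    K j ⊆ chain K s t := fun _ hx => mem_chain.2 ⟨j, hs, ht, hx⟩

end Chain

/-! ### Cyclic unions of pieces and their cuts by two points -/

section Ring

variable {α : Type*} [TopologicalSpace α]

/-- `X` is a cyclic union of `n` closed connected sets `K j` without cut points, indexed periodically, where
`K j` meets only its two neighbours, `K (j + 1)` in the single node `p j`. -/
structure IsRing (n : ℕ) (X : Set α) (K : ℕ → Set α) (p : ℕ → α) : Prop where
  three_le : 3 ≤ n
  periodic : ∀ j, K (j + n) = K j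
  node_periodic : ∀ j, p (j + n) = p j
  iUnion_eq : ⋃ j, K j = X
  node_mem : ∀ j, p j ∈ K j
  node_mem_succ : ∀ j, p j ∈ K (j + 1)
  eq_node : ∀ i j x, i < j → j < i + n → x ∈ K i → x ∈ K j →
    (j = i + 1 ∧ x = p i) ∨ (j + 1 = i + n ∧ x = p j)
  node_ne : ∀ i j, i < j → j < i + n → p i ≠ p j
  isClosed : ∀ j, IsClosed (K j)
  nontrivial : ∀ j, (K j).Nontrivial
  isPreconnected : ∀ j, IsPreconnected (K j)
  isPreconnected_diff : ∀ j x, IsPreconnected (K j \ {x})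
  hasOpenComponents : ∀ j, HasOpenComponents (K j)

namespace IsRing

variable {n : ℕ} {X : Set α} {K : ℕ → Set α} {p : ℕ → α}

theorem exists_eq_of_le (h : IsRing n X K p) (s i : ℕ) :
    ∃ j, s ≤ j ∧ j < s + n ∧ K j = K i ∧ p j = p i := by
  have hn : 0 < n := by have := h.three_le; lia
  have hs : s ≤ s * n := Nat.le_mul_of_pos_right s hn
  -- Adding `s * n ≥ s` keeps the natural subtraction from truncating and does not change the
  -- residue modulo `n`.
  have hmod : (s + (i + s * n - s) % n) % n = i % n := by
    rw [Nat.add_mod_mod, show s + (i + s * n - s) = i + s * n by lia, Nat.add_mul_mod_self_right]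
  refine ⟨s + (i + s * n - s) % n, by lia, ?_, ?_, ?_⟩
  · have := Nat.mod_lt (i + s * n - s) hn
    lia
  · rw [← Function.Periodic.map_mod_nat (f := K) h.periodic i, ← hmod,
      Function.Periodic.map_mod_nat (f := K) h.periodic]
  · rw [← Function.Periodic.map_mod_nat (f := p) h.node_periodic i, ← hmod,
      Function.Periodic.map_mod_nat (f := p) h.node_periodic]

theorem chain_eq (h : IsRing n X K p) (s : ℕ) : chain K s (s + n) = X := by
  rw [← h.iUnion_eq]
  refine Subset.antisymm (fun x hx => ?_) (fun x hx => ?_)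
  · obtain ⟨j, -, -, hx⟩ := mem_chain.1 hx
    exact mem_iUnion.2 ⟨j, hx⟩
  · obtain ⟨i, hx⟩ := mem_iUnion.1 hx
    obtain ⟨j, h1, h2, h3, -⟩ := h.exists_eq_of_le s i
    exact mem_chain.2 ⟨j, h1, h2, h3 ▸ hx⟩

theorem piece_union_chain (h : IsRing n X K p) (i : ℕ) :
    K (i + 1) ∪ chain K (i + 2) (i + n + 1) = X := by
  have := h.three_le
  rw [← chain_succ_self K (i + 1), chain_union_chain K (by lia) (by lia), ← h.chain_eq (i + 1)]
  congr 1
  lia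

theorem node_notMem (h : IsRing n X K p) {i j : ℕ} (h1 : i + 1 < j) (h2 : j < i + n) :
    p i ∉ K j := by
  intro hj
  rcases h.eq_node i j _ (by lia) h2 (h.node_mem i) hj with ⟨h3, -⟩ | ⟨-, h3⟩
  · lia
  · exact h.node_ne i j (by lia) h2 h3

theorem node_notMem_of_lt (h : IsRing n X K p) {i j : ℕ} (h1 : i < j) (h2 : j + 1 < i + n) :
    p j ∉ K i := by
  intro hi
  rcases h.eq_node i j _ (by lia) (by lia) hi (h.node_mem j) with ⟨-, h3⟩ | ⟨h3, -⟩
  · exact h.node_ne i j h1 (by lia) h3.symm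
  · lia

theorem isPreconnected_diff_of_subsingleton (h : IsRing n X K p) {j : ℕ} {S : Set α}
    (hS : (K j ∩ S).Subsingleton) : IsPreconnected (K j \ S) := by
  rw [← sdiff_self_inter]
  rcases hS.eq_empty_or_singleton with h' | ⟨x, h'⟩
  · simpa [h'] using h.isPreconnected j
  · rw [h']
    exact h.isPreconnected_diff j x

/-- Each piece loses at most one point and so stays connected, and consecutive pieces still share
their node. -/
theorem isPreconnected_chain_diff (h : IsRing n X K p) {s t : ℕ} {S : Set α}
    (hS : ∀ j, s ≤ j → j < t → (K j ∩ S).Subsingleton)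
    (hp : ∀ j, s ≤ j → j + 1 < t → p j ∉ S) : IsPreconnected (chain K s t \ S) := by
  have : chain K s t \ S = ⋃ j ∈ Ico s t, K j \ S := by
    simp only [chain, iUnion_sdiff]
  rw [this]
  refine IsPreconnected.biUnion_of_chain ordConnected_Ico
    (fun j hj => h.isPreconnected_diff_of_subsingleton (hS j hj.1 hj.2)) fun j hj hj' => ?_
  have hpj := hp j hj.1 hj'.2
  exact ⟨p j, ⟨h.node_mem j, hpj⟩, h.node_mem_succ j, hpj⟩

theorem isPreconnected_chain_diff_singleton (h : IsRing n X K p) {s t : ℕ} {x : α}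
    (hp : ∀ j, s ≤ j → j + 1 < t → x ≠ p j) : IsPreconnected (chain K s t \ {x}) :=
  h.isPreconnected_chain_diff (fun _ _ _ => subsingleton_singleton.anti inter_subset_right)
    fun j hj hj' h' => hp j hj hj' h'.symm

theorem isPreconnected_chain (h : IsRing n X K p) (s t : ℕ) : IsPreconnected (chain K s t) := by
  simpa using h.isPreconnected_chain_diff (s := s) (t := t) (S := ∅) (by simp) (by simp)

theorem isClosed_chain (h : IsRing n X K p) (s t : ℕ) : IsClosed (chain K s t) :=
  (finite_Ico s t).isClosed_biUnion fun j _ => h.isClosed j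

theorem nontrivial_chain (h : IsRing n X K p) {s t : ℕ} (hst : s < t) :
    (chain K s t).Nontrivial :=
  (h.nontrivial s).mono (subset_chain K le_rfl hst)

theorem isPreconnected_total (h : IsRing n X K p) : IsPreconnected X :=
  h.chain_eq 0 ▸ h.isPreconnected_chain _ _

theorem isClosed_total (h : IsRing n X K p) : IsClosed X :=
  h.chain_eq 0 ▸ h.isClosed_chain _ _

theorem nontrivial_total (h : IsRing n X K p) : X.Nontrivial :=
  h.chain_eq 0 ▸ h.nontrivial_chain (by have := h.three_le; lia)

/-- The bound `r < s + n` leaves out at least one piece, so the two runs cannot meet again on the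
far side of the ring. -/
theorem chain_inter_chain (h : IsRing n X K p) {s t r : ℕ} (hr : r < s + n) :
    chain K s (t + 1) ∩ chain K (t + 1) r ⊆ {p t} := by
  rintro x ⟨hx, hx'⟩
  obtain ⟨i, h1, h2, hi⟩ := mem_chain.1 hx
  obtain ⟨j, h3, h4, hj⟩ := mem_chain.1 hx'
  rcases h.eq_node i j x (by lia) (by lia) hi hj with ⟨h5, h6⟩ | ⟨h5, h6⟩
  · obtain rfl : i = t := by lia
    exact h6
  · lia

/-- Two complementary chains meet exactly in their common end nodes. -/
theorem chain_inter_chain_compl (h : IsRing n X K p) {i j : ℕ} (hij : i < j) (hj : j < i + n) :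
    chain K (i + 1) (j + 1) ∩ chain K (j + 1) (i + n + 1) = {p i, p j} := by
  refine Subset.antisymm ?_ ?_
  · rintro x ⟨hx, hx'⟩
    obtain ⟨k, h1, h2, hk⟩ := mem_chain.1 hx
    obtain ⟨l, h3, h4, hl⟩ := mem_chain.1 hx'
    rcases h.eq_node k l x (by lia) (by lia) hk hl with ⟨h5, h6⟩ | ⟨h5, h6⟩
    · obtain rfl : k = j := by lia
      exact Or.inr h6
    · obtain rfl : l = i + n := by lia
      exact Or.inl (h6.trans (h.node_periodic i))
  · rintro x (rfl | rfl)
    · refine ⟨subset_chain K le_rfl (by lia) (h.node_mem_succ i),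
        subset_chain K (j := i + n) (by lia) (by lia) ?_⟩
      rw [h.periodic]
      exact h.node_mem i
    · exact ⟨subset_chain K hij (by lia) (h.node_mem j),
        subset_chain K le_rfl (by lia) (h.node_mem_succ j)⟩

theorem piece_inter_chain (h : IsRing n X K p) (i : ℕ) :
    K (i + 1) ∩ chain K (i + 2) (i + n + 1) = {p i, p (i + 1)} := by
  have := h.three_le
  rw [← h.chain_inter_chain_compl (i := i) (j := i + 1) (by lia) (by lia), chain_succ_self]

theorem isCutPoint_chain_iff (h : IsRing n X K p) {s t : ℕ} (ht : t < s + n) {x : α} :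
    IsCutPoint (chain K s t) x ↔ ∃ j, s ≤ j ∧ j + 1 < t ∧ x = p j := by
  rw [isCutPoint_iff (h.isPreconnected_chain s t)]
  constructor
  · rintro ⟨-, hx⟩
    by_contra! hne
    exact hx (h.isPreconnected_chain_diff_singleton hne)
  · rintro ⟨j, hs, hj, rfl⟩
    refine ⟨subset_chain K hs (by lia) (h.node_mem j), fun hpre => ?_⟩
    obtain ⟨y, hy, hyp⟩ := (h.nontrivial j).exists_ne (p j)
    obtain ⟨w, hw, hwp⟩ := (h.nontrivial (j + 1)).exists_ne (p j)
    have hy' : y ∈ chain K s (j + 1) := subset_chain K hs (by lia) hy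
    have hw' : w ∈ chain K (j + 1) t := subset_chain K le_rfl hj hw
    have hun := chain_union_chain K (s := s) (t := j + 1) (r := t) (by lia) (by lia)
    obtain ⟨q, hq, hq'⟩ := isPreconnected_closed_iff.1 hpre _ _ (h.isClosed_chain s (j + 1))
      (h.isClosed_chain (j + 1) t) (hun ▸ sdiff_subset) ⟨y, ⟨hun ▸ Or.inl hy', hyp⟩, hy'⟩
      ⟨w, ⟨hun ▸ Or.inr hw', hwp⟩, hw'⟩
    exact hq.2 (h.chain_inter_chain ht hq')

theorem ncp_chain (h : IsRing n X K p) {s t : ℕ} (ht : t < s + n) :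
    ncp (chain K s t) = ((t - 1 - s : ℕ) : ℕ∞) := by
  have : {x | IsCutPoint (chain K s t) x} = p '' (Ico s (t - 1)) := by
    ext x
    rw [mem_ofPred_eq, h.isCutPoint_chain_iff ht]
    constructor
    · rintro ⟨j, h1, h2, rfl⟩
      exact ⟨j, ⟨h1, by lia⟩, rfl⟩
    · rintro ⟨j, ⟨h1, h2⟩, rfl⟩
      exact ⟨j, h1, by lia, rfl⟩
  rw [ncp, this, InjOn.encard_image]
  · rw [← Finset.coe_Ico, encard_coe_eq_coe_finsetCard, Nat.card_Ico]
  · intro i hi j hj hij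
    rcases lt_trichotomy i j with hlt | rfl | hlt
    · exact absurd hij (h.node_ne i j hlt (by have := hi.1; have := hj.2; lia))
    · rfl
    · exact absurd hij.symm (h.node_ne j i hlt (by have := hj.1; have := hi.2; lia))

/-- With at least two pieces, no piece contains both ends; a single piece could be disconnected by
removing both its nodes. Removing an inner node leaves two halves, each with one end, and any other
inner point leaves the run connected. -/
theorem isLink_chain (h : IsRing n X K p) {i j : ℕ} (hij : i + 2 ≤ j) (hj : j < i + n) :
    IsLink (chain K (i + 1) (j + 1)) (p i) (p j) where
  isClosed := h.isClosed_chain _ _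
  ne := h.node_ne i j (by lia) hj
  left_mem := subset_chain K le_rfl (by lia) (h.node_mem_succ i)
  right_mem := subset_chain K (by lia) (by lia) (h.node_mem j)
  isPreconnected_diff S hS := by
    refine h.isPreconnected_chain_diff (fun l h1 h2 x hx y hy => ?_) fun l h1 h2 hl => ?_
    · have hx' := hS ⟨hx.2, subset_chain K h1 h2 hx.1⟩
      have hy' := hS ⟨hy.2, subset_chain K h1 h2 hy.1⟩
      have key : ¬ (p i ∈ K l ∧ p j ∈ K l) := by
        rintro ⟨h3, h4⟩
        by_cases hl : l = j
        · exact h.node_notMem (by lia) (by lia) h3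
        · exact h.node_notMem_of_lt (by lia) (by lia) h4
      rcases hx' with rfl | rfl <;> rcases hy' with rfl | rfl
      · rfl
      · exact absurd ⟨hx.1, hy.1⟩ key
      · exact absurd ⟨hy.1, hx.1⟩ key
      · rfl
    · rcases hS ⟨hl, subset_chain K h1 (by lia) (h.node_mem l)⟩ with h3 | h3
      · exact h.node_ne i l (by lia) (by lia) h3.symm
      · exact h.node_ne l j (by lia) (by lia) h3
  exists_mem x hx hxi hxj y hy hyx := by
    by_cases hnode : ∃ l, i + 1 ≤ l ∧ l + 1 < j + 1 ∧ x = p l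
    · obtain ⟨l, h1, h2, rfl⟩ := hnode
      have hun := chain_union_chain K (s := i + 1) (t := l + 1) (r := j + 1) (by lia) (by lia)
      rcases (hun.symm ▸ hy : y ∈ chain K (i + 1) (l + 1) ∪ chain K (l + 1) (j + 1)) with hy | hy
      · refine ⟨chain K (i + 1) (l + 1) \ {p l},
          sdiff_subset_sdiff_left (hun ▸ subset_union_left), ?_, ⟨hy, hyx⟩,
          Or.inl ⟨subset_chain K le_rfl (by lia) (h.node_mem_succ i), hxi.symm⟩⟩
        exact h.isPreconnected_chain_diff_singleton fun k h3 h4 h5 =>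
          h.node_ne k l (by lia) (by lia) h5.symm
      · refine ⟨chain K (l + 1) (j + 1) \ {p l},
          sdiff_subset_sdiff_left (hun ▸ subset_union_right), ?_, ⟨hy, hyx⟩,
          Or.inr ⟨subset_chain K (by lia) (by lia) (h.node_mem j), hxj.symm⟩⟩
        exact h.isPreconnected_chain_diff_singleton fun k h3 h4 h5 =>
          h.node_ne l k (by lia) (by lia) h5
    · push Not at hnode
      exact ⟨_, Subset.rfl, h.isPreconnected_chain_diff_singleton hnode, ⟨hy, hyx⟩,
        Or.inl ⟨subset_chain K le_rfl (by lia) (h.node_mem_succ i), hxi.symm⟩⟩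

theorem isLink_compl (h : IsRing n X K p) (i : ℕ) :
    IsLink (chain K (i + 2) (i + n + 1)) (p i) (p (i + 1)) := by
  have := h.three_le
  have := h.isLink_chain (i := i + 1) (j := i + n) (by lia) (by lia)
  rw [h.node_periodic] at this
  exact this.symm

/-- If `x` is a node, the ring is opened there, so that `x` is not an inner node of the resulting
run of `n` pieces. -/
theorem isPreconnected_total_diff (h : IsRing n X K p) (x : α) : IsPreconnected (X \ {x}) := by
  obtain ⟨s, hs⟩ : ∃ s, ∀ j, s ≤ j → j + 1 < s + n → x ≠ p j := by
    by_cases hx : ∃ i, x = p i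
    · obtain ⟨i, rfl⟩ := hx
      exact ⟨i + 1, fun j h1 h2 => h.node_ne i j (by lia) (by lia)⟩
    · exact ⟨0, fun j _ _ h' => hx ⟨j, h'⟩⟩
  rw [← h.chain_eq s]
  exact h.isPreconnected_chain_diff_singleton hs

/-- A pair of points not contained in one piece and not consisting of two nodes does not
disconnect a ring. -/
theorem isPreconnected_total_diff_pair (h : IsRing n X K p) {a b : α}
    (hab : ∀ j, ¬ (a ∈ K j ∧ b ∈ K j)) (hnode : ¬ ((∃ i, a = p i) ∧ ∃ i, b = p i)) :
    IsPreconnected (X \ {a, b}) := by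
  -- At most one of `a, b` is a node; the ring is opened at that one.
  obtain ⟨s, hs⟩ : ∃ s, ∀ j, s ≤ j → j + 1 < s + n → p j ∉ ({a, b} : Set α) := by
    by_cases ha : ∃ i, a = p i
    · have hb : ¬ ∃ i, b = p i := fun hb => hnode ⟨ha, hb⟩
      obtain ⟨i, rfl⟩ := ha
      refine ⟨i + 1, fun j h1 h2 => ?_⟩
      rintro (h' | h')
      · exact h.node_ne i j (by lia) (by lia) h'.symm
      · exact hb ⟨j, h'.symm⟩
    · by_cases hb : ∃ i, b = p i
      · obtain ⟨i, rfl⟩ := hb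
        refine ⟨i + 1, fun j h1 h2 => ?_⟩
        rintro (h' | h')
        · exact ha ⟨j, h'.symm⟩
        · exact h.node_ne i j (by lia) (by lia) h'.symm
      · refine ⟨0, fun j _ _ => ?_⟩
        rintro (h' | h')
        · exact ha ⟨j, h'.symm⟩
        · exact hb ⟨j, h'.symm⟩
  rw [← h.chain_eq s]
  refine h.isPreconnected_chain_diff (fun j _ _ x hx y hy => ?_) hs
  rcases hx with ⟨hx, rfl | rfl⟩ <;> rcases hy with ⟨hy, rfl | rfl⟩
  · rfl
  · exact absurd ⟨hx, hy⟩ (hab j)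
  · exact absurd ⟨hy, hx⟩ (hab j)
  · rfl

theorem ncp_total (h : IsRing n X K p) : ncp X = 0 := by
  rw [ncp, encard_eq_zero, eq_empty_iff_forall_notMem]
  exact fun x hx => hx.2.1 (h.isPreconnected_total_diff x)

/-- Two points of a chain without a common piece are separated by an inner node. -/
theorem exists_node_between (h : IsRing n X K p) {s t : ℕ} {u v : α} (hu : u ∈ chain K s t)
    (hv : v ∈ chain K s t) (huv : ∀ j, ¬ (u ∈ K j ∧ v ∈ K j)) :
    ∃ j, s ≤ j ∧ j + 1 < t ∧ u ≠ p j ∧ v ≠ p j ∧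
      ((u ∈ chain K s (j + 1) ∧ v ∈ chain K (j + 1) t) ∨
        (v ∈ chain K s (j + 1) ∧ u ∈ chain K (j + 1) t)) := by
  obtain ⟨i, hi1, hi2, hi⟩ := mem_chain.1 hu
  obtain ⟨k, hk1, hk2, hk⟩ := mem_chain.1 hv
  wlog hik : i < k generalizing i k u v
  · obtain ⟨j, h1, h2, h3, h4, h5⟩ := this hv hu (fun j h' => huv j h'.symm) k hk1 hk2 hk i hi1 hi2 hi
      (by
        have : i ≠ k := by rintro rfl; exact huv i ⟨hi, hk⟩
        lia)
    exact ⟨j, h1, h2, h4, h3, h5.symm⟩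
  clear hu hv hk1 hi2
  obtain ⟨m, rfl⟩ := Nat.exists_eq_add_of_lt hik
  clear hik
  -- If `u` is the node `p i`, it also belongs to the next piece and the gap shrinks; otherwise `p
  -- i` separates.
  induction m generalizing i with
  | zero =>
    refine ⟨i, hi1, hk2, ?_, ?_, Or.inl ⟨subset_chain K hi1 (by lia) hi,
      subset_chain K (by lia) hk2 hk⟩⟩
    · rintro rfl
      exact huv _ ⟨h.node_mem_succ i, hk⟩
    · rintro rfl
      exact huv _ ⟨hi, h.node_mem i⟩
  | succ m ih =>
    by_cases hui : u = p i
    · refine ih (i + 1) (by lia) (hui ▸ h.node_mem_succ i) ?_ ?_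
      · rwa [show i + 1 + m + 1 = i + (m + 1) + 1 by lia]
      · lia
    · refine ⟨i, hi1, by lia, hui, ?_, Or.inl ⟨subset_chain K hi1 (by lia) hi,
        subset_chain K (by lia) hk2 hk⟩⟩
      rintro rfl
      exact huv _ ⟨hi, h.node_mem i⟩

variable [T1Space α]

theorem closure_chain_diff (h : IsRing n X K p) {s t : ℕ} (hst : s < t) (a b : α) :
    closure (chain K s t \ {a, b}) = chain K s t :=
  (closure_minimal sdiff_subset (h.isClosed_chain s t)).antisymm
    (subset_closure_diff_finite (h.isPreconnected_chain s t) (h.nontrivial_chain hst) (by simp))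

/-- Both arcs between non-adjacent nodes have at least two, hence at most `n - 2` pieces, and so at
most `n - 3` inner nodes. As links they stay connected without their ends. -/
theorem ncp_closure_lt_of_nodes (h : IsRing n X K p) {i j : ℕ} {C : Set α} (hij : i + 2 ≤ j)
    (hj : j + 2 ≤ i + n) (hC : IsComponent (X \ {p i, p j}) C) :
    ncp (closure C) < ((n - 2 : ℕ) : ℕ∞) := by
  have hX : chain K (i + 1) (j + 1) ∪ chain K (j + 1) (i + n + 1) = X := by
    rw [chain_union_chain K (by lia) (by lia), ← h.chain_eq (i + 1)]
    congr 1
    lia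
  have hinter := h.chain_inter_chain_compl (i := i) (j := j) (by lia) (by lia)
  have h1 := (h.isLink_chain (i := i) (j := j) hij (by lia)).isPreconnected_diff {p i, p j}
    inter_subset_left
  have h2 := (h.isLink_chain (i := j) (j := i + n) (by lia) (by lia)).isPreconnected_diff
    {p i, p j} (by rw [h.node_periodic, pair_comm]; exact inter_subset_left)
  rw [← hX] at hC
  rcases hC.eq_or_of_inter_subset (h.isClosed_chain _ _) (h.isClosed_chain _ _) hinter.subset h2
    with rfl | ⟨hC', -⟩
  · rw [h.closure_chain_diff (by lia), h.ncp_chain (by lia)]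
    exact_mod_cast (by lia)
  · rw [hC'.eq_of_isPreconnected h1, h.closure_chain_diff (by lia), h.ncp_chain (by lia)]
    exact_mod_cast (by lia)

/-- The possible closures of the components of the complement of a pair of points. -/
theorem component_cases (h : IsRing n X K p) {a b : α} {C : Set α}
    (hab : a ≠ b) (hC : IsComponent (X \ {a, b}) C) :
    ncp (closure C) < ((n - 2 : ℕ) : ℕ∞) ∨
    (∃ i, ({a, b} : Set α) = {p i, p (i + 1)} ∧ closure C = chain K (i + 2) (i + n + 1)) ∨
    (∃ i, a ∈ K (i + 1) ∧ b ∈ K (i + 1) ∧ IsComponent (K (i + 1) \ {a, b}) C ∧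
      p i ∉ C ∧ p (i + 1) ∉ C) ∨
    (∃ i, a ∈ K (i + 1) ∧ b ∈ K (i + 1) ∧ ∃ D, IsComponent (K (i + 1) \ {a, b}) D ∧
      p i ∈ closure D ∧ p (i + 1) ∈ closure D ∧
      closure C = closure D ∪ chain K (i + 2) (i + n + 1) ∧
      ∀ x, IsCutPoint (closure C) x → IsCutPoint (closure D) x) := by
  have hn := h.three_le
  have hzero : ((0 : ℕ) : ℕ∞) < ((n - 2 : ℕ) : ℕ∞) := by exact_mod_cast (by lia)
  by_cases hsame : ∃ j, a ∈ K j ∧ b ∈ K j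
  · obtain ⟨k, hak, hbk⟩ := hsame
    -- A representative `j ≥ 1` has the form `i + 1`, so the end nodes of the piece are `p i` and `p
    -- (i + 1)`.
    obtain ⟨j, hj1, -, hjk, -⟩ := h.exists_eq_of_le 1 k
    obtain ⟨i, rfl⟩ : ∃ i, j = i + 1 := ⟨j - 1, by lia⟩
    rw [← hjk] at hak hbk
    rw [← h.piece_union_chain i] at hC
    have hinter := h.piece_inter_chain i
    have hlink := h.isLink_compl i
    by_cases hpair : ({a, b} : Set α) = {p i, p (i + 1)}
    · have hQ := hlink.isPreconnected_diff {a, b} (by rw [hpair]; exact inter_subset_left)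
      rcases hC.eq_or_of_inter_subset (h.isClosed _) hlink.isClosed (by rw [hinter, hpair]) hQ
        with rfl | ⟨hC', hd⟩
      · exact Or.inr (Or.inl ⟨i, hpair, h.closure_chain_diff (by lia) a b⟩)
      · exact Or.inr (Or.inr (Or.inl ⟨i, hak, hbk, hC', fun h' =>
          disjoint_left.1 hd h' hlink.left_mem, fun h' => disjoint_left.1 hd h' hlink.right_mem⟩))
    · rcases hlink.component_cases (h.isClosed _) (h.hasOpenComponents _)
        (h.isPreconnected_diff _) hinter hak hbk hab hpair hC with hC' | hC' | hC'
      · exact Or.inr (Or.inr (Or.inl ⟨i, hak, hbk, hC'⟩))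
      · exact Or.inr (Or.inr (Or.inr ⟨i, hak, hbk, hC'⟩))
      · left
        have : ncp (closure C) = 0 := encard_eq_zero.2 (eq_empty_iff_forall_notMem.2 hC')
        rw [this]
        exact hzero
  · push Not at hsame
    left
    by_cases hnode : (∃ i, a = p i) ∧ ∃ i, b = p i
    · obtain ⟨⟨i, rfl⟩, ⟨j, rfl⟩⟩ := hnode
      obtain ⟨i, -, hi, -, hpi⟩ := h.exists_eq_of_le 0 i
      obtain ⟨j, -, hj, -, hpj⟩ := h.exists_eq_of_le 0 j
      rw [← hpi, ← hpj] at hC hsame hab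
      clear hpi hpj
      wlog hij : i < j generalizing i j
      · have hne : i ≠ j := fun h' => hab (h' ▸ rfl)
        rw [pair_comm] at hC
        exact this j hj i hab.symm (fun k h1 h2 => hsame k h2 h1) hC hi (by lia)
      refine h.ncp_closure_lt_of_nodes (i := i) (j := j) ?_ ?_ hC
      · have : j ≠ i + 1 := by
          rintro rfl
          exact hsame _ (h.node_mem_succ i) (h.node_mem _)
        lia
      · have : j + 1 ≠ i + n := by
          intro h'
          refine hsame (i + n) ?_ (h' ▸ h.node_mem_succ j)
          rw [h.periodic]
          exact h.node_mem i
        lia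
    · have hpre := h.isPreconnected_total_diff_pair (fun j h' => hsame j h'.1 h'.2) hnode
      have hX : closure (X \ {a, b}) = X :=
        (closure_minimal sdiff_subset h.isClosed_total).antisymm
          (subset_closure_diff_finite h.isPreconnected_total h.nontrivial_total (by simp))
      rw [hC.eq_of_isPreconnected hpre, hX, h.ncp_total]
      exact hzero

end IsRing

end Ring

/-! ### Invariance under homeomorphisms -/

section Image

variable {α : Type*} [TopologicalSpace α]

theorem IsComponent.image {Y C : Set α} (h : IsComponent Y C) (e : α ≃ₜ α) :
    IsComponent (e '' Y) (e '' C) := by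
  obtain ⟨x, hx, rfl⟩ := h
  exact ⟨e x, mem_image_of_mem e hx, e.image_connectedComponentIn hx⟩

theorem isCutPoint_image_iff {X : Set α} (hX : IsPreconnected X) (e : α ≃ₜ α) {x : α} :
    IsCutPoint (e '' X) (e x) ↔ IsCutPoint X x := by
  rw [isCutPoint_iff hX, isCutPoint_iff (hX.image e e.continuous.continuousOn), ← image_singleton,
    ← image_sdiff e.injective, e.isPreconnected_image, e.injective.mem_set_image]

theorem ncp_image {X : Set α} (hX : IsPreconnected X) (e : α ≃ₜ α) : ncp (e '' X) = ncp X := by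
  have : {x | IsCutPoint (e '' X) x} = e '' {x | IsCutPoint X x} := by
    ext y
    obtain ⟨x, rfl⟩ := e.surjective y
    rw [e.injective.mem_set_image]
    exact isCutPoint_image_iff hX e
  rw [ncp, this, e.injective.encard_image]
  rfl

theorem HasOpenComponents.image {P : Set α} (hP : HasOpenComponents P) (e : α ≃ₜ α) :
    HasOpenComponents (e '' P) := by
  intro U hU y
  obtain ⟨x, rfl⟩ := e.surjective y
  by_cases hx : x ∈ P ∩ e ⁻¹' U
  · obtain ⟨O, hO, hPO⟩ := hP (e ⁻¹' U) (hU.preimage e.continuous) x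
    refine ⟨e '' O, e.isOpenMap O hO, ?_⟩
    rw [← image_inter e.injective, ← hPO, e.image_connectedComponentIn hx, image_inter_preimage]
  · refine ⟨∅, isOpen_empty, ?_⟩
    rw [inter_empty]
    refine connectedComponentIn_eq_empty fun h => hx ?_
    rw [← image_inter_preimage, e.injective.mem_set_image] at h
    exact h

end Image

/-! ### Connectedness and local connectedness of the attractor -/

section Attractor

variable {α : Type*} [MetricSpace α] {F : Set α} {g : ℕ → α ≃ₜ α} {c : ℝ}

/-- A splitting of `F` into two closed parts has a positive gap. Pulling it back along `g j` widens
the gap by `1 / c`, until it exceeds the diameter and one part is empty. Going back, every piece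
lies in one part, and consecutive pieces meet, so all lie in the same part. -/
theorem isPreconnected_of_selfSimilar (hF : IsCompact F) (hun : ⋃ j, g j '' F = F)
    (hc0 : 0 < c) (hc1 : c < 1) (hg : ∀ j x y, dist (g j x) (g j y) ≤ c * dist x y)
    (hmeet : ∀ j, (g j '' F ∩ g (j + 1) '' F).Nonempty) : IsPreconnected F := by
  have key : ∀ N : ℕ, ∀ U V : Set α, F ⊆ U ∪ V →
      (∀ x ∈ F ∩ U, ∀ y ∈ F ∩ V, Metric.diam F * c ^ N < dist x y) → F ⊆ U ∨ F ⊆ V := by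
    intro N
    induction N with
    | zero =>
      intro U V hUV hsep
      by_contra! hne
      obtain ⟨⟨y, hyF, hyU⟩, ⟨x, hxF, hxV⟩⟩ := hne.imp not_subset.1 not_subset.1
      have h1 := hsep x ⟨hxF, (hUV hxF).resolve_right hxV⟩ y ⟨hyF, (hUV hyF).resolve_left hyU⟩
      have h2 := Metric.dist_le_diam_of_mem hF.isBounded hxF hyF
      rw [pow_zero, mul_one] at h1
      exact absurd h1 (not_lt.2 h2)
    | succ N ih =>
      intro U V hUV hsep
      have hsub : ∀ j, ∀ x ∈ F, g j x ∈ F := fun j x hx =>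
        hun.subset (mem_iUnion.2 ⟨j, mem_image_of_mem _ hx⟩)
      have hdisj : ∀ x ∈ F, ¬ (x ∈ U ∧ x ∈ V) := by
        rintro x hx ⟨h1, h2⟩
        have := hsep x ⟨hx, h1⟩ x ⟨hx, h2⟩
        rw [dist_self] at this
        exact absurd this (not_lt.2 (mul_nonneg Metric.diam_nonneg (pow_nonneg hc0.le _)))
      have hpiece : ∀ j, g j '' F ⊆ U ∨ g j '' F ⊆ V := by
        intro j
        rw [image_subset_iff, image_subset_iff]
        refine ih _ _ (fun x hx => hUV (hsub j x hx)) fun x hx y hy => ?_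
        have h1 := hsep (g j x) ⟨hsub j x hx.1, hx.2⟩ (g j y) ⟨hsub j y hy.1, hy.2⟩
        have h2 := hg j x y
        rw [pow_succ, ← mul_assoc, mul_comm _ c] at h1
        exact lt_of_mul_lt_mul_left (h1.trans_le h2) hc0.le
      have hstep : ∀ U V : Set α, (∀ x ∈ F, ¬ (x ∈ U ∧ x ∈ V)) →
          (∀ j, g j '' F ⊆ U ∨ g j '' F ⊆ V) → g 0 '' F ⊆ U → F ⊆ U := by
        intro U V hdisj hpiece h0
        have : ∀ j, g j '' F ⊆ U := by
          intro j
          induction j with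
          | zero => exact h0
          | succ j ihj =>
            refine (hpiece (j + 1)).resolve_right fun h' => ?_
            obtain ⟨x, hx1, hx2⟩ := hmeet j
            exact hdisj x (hun.subset (mem_iUnion.2 ⟨j, hx1⟩)) ⟨ihj hx1, h' hx2⟩
        exact hun.symm.subset.trans (iUnion_subset this)
      rcases hpiece 0 with h0 | h0
      · exact Or.inl (hstep U V hdisj hpiece h0)
      · exact Or.inr (hstep V U (fun x hx h => hdisj x hx h.symm) (fun j => (hpiece j).symm) h0)
  rw [isPreconnected_iff_subset_of_disjoint_closed]
  intro U V hU hV hUV hdisj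
  have hd : Disjoint (F ∩ U) (F ∩ V) := by
    rw [disjoint_left]
    intro x h1 h2
    exact (hdisj.subset ⟨h1.1, h1.2, h2.2⟩ : x ∈ (∅ : Set α))
  obtain ⟨δ, hδ, hth⟩ := hd.exists_thickenings (hF.inter_right hU) (hF.isClosed.inter hV)
  have hlim : Filter.Tendsto (fun N : ℕ => Metric.diam F * c ^ N) Filter.atTop (nhds 0) := by
    simpa using (tendsto_pow_atTop_nhds_zero_of_lt_one hc0.le hc1).const_mul (Metric.diam F)
  obtain ⟨N, hN⟩ := (hlim.eventually_lt_const hδ).exists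
  refine key N U V hUV fun x hx y hy => hN.trans_le ?_
  by_contra! hlt
  exact disjoint_left.1 hth (Metric.mem_thickening_iff.2 ⟨x, hx, by rwa [dist_comm]⟩)
    (Metric.self_subset_thickening hδ _ hy)

/-- For each `N`, `F` is a finite union of closed connected copies of diameter at most `diam F * c ^
N`. Away from the finitely many copies that miss `y`, every point of `F` shares a small connected
copy with `y`. -/
theorem hasOpenComponents_of_selfSimilar {n : ℕ} (hF : IsCompact F)
    (hun : ⋃ j ∈ Iio n, g j '' F = F) (hFc : IsPreconnected F)
    (hc0 : 0 < c) (hc1 : c < 1) (hg : ∀ j x y, dist (g j x) (g j y) ≤ c * dist x y) :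
    HasOpenComponents F := by
  have cover : ∀ N : ℕ, ∃ S : Set (Set α), S.Finite ∧ ⋃₀ S = F ∧ ∀ s ∈ S, IsClosed s ∧
      IsPreconnected s ∧ ∀ x ∈ s, ∀ y ∈ s, dist x y ≤ Metric.diam F * c ^ N := by
    intro N
    induction N with
    | zero =>
      refine ⟨{F}, finite_singleton F, sUnion_singleton F, ?_⟩
      rintro s rfl
      refine ⟨hF.isClosed, hFc, fun x hx y hy => ?_⟩
      simpa using Metric.dist_le_diam_of_mem hF.isBounded hx hy
    | succ N ih =>
      obtain ⟨S, hS, hSF, h⟩ := ih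
      refine ⟨image2 (fun j s => g j '' s) (Iio n) S, (finite_Iio n).image2 _ hS, ?_, ?_⟩
      · rw [sUnion_image2]
        conv_rhs => rw [← hun, ← hSF]
        simp only [sUnion_eq_biUnion, image_iUnion]
      · rintro _ ⟨j, -, s, hs, rfl⟩
        obtain ⟨h1, h2, h3⟩ := h s hs
        refine ⟨(g j).isClosedMap s h1, (g j).isPreconnected_image.2 h2, ?_⟩
        rintro _ ⟨x, hx, rfl⟩ _ ⟨y, hy, rfl⟩
        rw [pow_succ, ← mul_assoc, mul_comm _ c]
        exact (hg j x y).trans (mul_le_mul_of_nonneg_left (h3 x hx y hy) hc0.le)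
  intro U hU x
  have hnhds : ∀ y ∈ connectedComponentIn (F ∩ U) x, ∃ W, IsOpen W ∧ y ∈ W ∧
      F ∩ W ⊆ connectedComponentIn (F ∩ U) x := by
    intro y hy
    obtain ⟨ε, hε, hball⟩ := Metric.isOpen_iff.1 hU y (connectedComponentIn_subset _ _ hy).2
    have hlim : Filter.Tendsto (fun N : ℕ => Metric.diam F * c ^ N) Filter.atTop (nhds 0) := by
      simpa using (tendsto_pow_atTop_nhds_zero_of_lt_one hc0.le hc1).const_mul (Metric.diam F)
    obtain ⟨N, hN⟩ := (hlim.eventually_lt_const hε).exists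
    obtain ⟨S, hS, hSF, h⟩ := cover N
    refine ⟨(⋃₀ {s ∈ S | y ∉ s})ᶜ, ?_, ?_, ?_⟩
    · rw [sUnion_eq_biUnion, isOpen_compl_iff]
      exact (hS.subset (sep_subset _ _)).isClosed_biUnion fun s hs => (h s hs.1).1
    · rintro ⟨s, hs, hys⟩
      exact hs.2 hys
    · rintro w ⟨hwF, hw⟩
      rw [← hSF] at hwF
      obtain ⟨s, hs, hws⟩ := hwF
      have hys : y ∈ s := by_contra fun hys => hw ⟨s, ⟨hs, hys⟩, hws⟩
      have hsU : s ⊆ F ∩ U := fun q hq => ⟨hSF ▸ ⟨s, hs, hq⟩,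
        hball (((h s hs).2.2 q hq y hys).trans_lt hN)⟩
      rw [connectedComponentIn_eq hy]
      exact (h s hs).2.1.subset_connectedComponentIn hys hsU hws
  choose! W hW1 hW2 hW3 using hnhds
  refine ⟨⋃ y ∈ connectedComponentIn (F ∩ U) x, W y, isOpen_biUnion hW1, ?_⟩
  refine Subset.antisymm (fun y hy => ⟨(connectedComponentIn_subset _ _ hy).1,
    mem_biUnion hy (hW2 y hy)⟩) ?_
  rintro w ⟨hwF, hw⟩
  obtain ⟨y, hy, hwy⟩ := mem_iUnion₂.1 hw
  exact hW3 y hy ⟨hwF, hwy⟩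

end Attractor

/-! ### The bound on cut points and the case of equality -/

section SelfSimilarRing

variable {α : Type*} [MetricSpace α]

/-- A ring whose pieces are contracted copies of the whole. -/
structure IsSelfSimilarRing (n : ℕ) (F : Set α) (g : ℕ → α ≃ₜ α) (p : ℕ → α) (c : ℝ) : Prop where
  isRing : IsRing n F (fun j => g j '' F) p
  isCompact : IsCompact F
  pos : 0 < c
  lt_one : c < 1
  dist_le : ∀ j x y, dist (g j x) (g j y) ≤ c * dist x y

namespace IsSelfSimilarRing

variable {n : ℕ} {F : Set α} {g : ℕ → α ≃ₜ α} {p : ℕ → α} {c : ℝ}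

theorem exists_pow_lt (h : IsSelfSimilarRing n F g p c) {a b : α} (hab : a ≠ b) :
    ∃ N : ℕ, Metric.diam F * c ^ N < dist a b := by
  have hlim : Filter.Tendsto (fun N : ℕ => Metric.diam F * c ^ N) Filter.atTop (nhds 0) := by
    simpa using (tendsto_pow_atTop_nhds_zero_of_lt_one h.pos.le h.lt_one).const_mul (Metric.diam F)
  exact (hlim.eventually_lt_const (dist_pos.2 hab)).exists

/-- Components of the complement of a pair in a piece are copies of such components of the whole,
with the points of the pair further apart. -/
theorem exists_pullback (h : IsSelfSimilarRing n F g p c) {k N : ℕ} {a b : α} {D : Set α}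
    (ha : a ∈ g k '' F) (hb : b ∈ g k '' F) (hN : Metric.diam F * c ^ (N + 1) < dist a b)
    (hD : IsComponent (g k '' F \ {a, b}) D) :
    ∃ a' ∈ F, ∃ b' ∈ F, ∃ D', g k a' = a ∧ g k b' = b ∧ g k '' D' = D ∧
      Metric.diam F * c ^ N < dist a' b' ∧ IsComponent (F \ {a', b'}) D' ∧
      closure D = g k '' closure D' ∧ ncp (closure D) = ncp (closure D') := by
  obtain ⟨a', ha', rfl⟩ := ha
  obtain ⟨b', hb', rfl⟩ := hb
  have hD' := hD.image (g k).symm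
  have hF : (g k).symm '' (g k '' F \ {g k a', g k b'}) = F \ {a', b'} := by
    rw [← image_pair, ← image_sdiff (g k).injective]
    exact (g k).toEquiv.symm_image_image _
  rw [hF] at hD'
  have hDD : g k '' ((g k).symm '' D) = D := (g k).toEquiv.image_symm_image D
  have hcl : closure D = g k '' closure ((g k).symm '' D) := by
    rw [(g k).image_closure, hDD]
  refine ⟨a', ha', b', hb', (g k).symm '' D, rfl, rfl, hDD, ?_, hD', hcl, ?_⟩
  · rw [pow_succ, ← mul_assoc, mul_comm _ c] at hN
    exact lt_of_mul_lt_mul_left (hN.trans_le (h.dist_le k a' b')) h.pos.le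
  · rw [hcl, ncp_image hD'.isPreconnected.closure]

/-- `N` bounds the number of pull-backs: each lowers it by one, and at `N = 0` the points would be
further apart than the diameter. -/
theorem ncp_closure_le (h : IsSelfSimilarRing n F g p c) {a b : α} {C : Set α} (ha : a ∈ F)
    (hb : b ∈ F) (hab : a ≠ b) (hC : IsComponent (F \ {a, b}) C) :
    ncp (closure C) ≤ ((n - 2 : ℕ) : ℕ∞) := by
  obtain ⟨N, hN⟩ := h.exists_pow_lt hab
  have hn := h.isRing.three_le
  induction N generalizing a b C with
  | zero =>
    rw [pow_zero, mul_one] at hN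
    exact absurd hN (not_lt.2 (Metric.dist_le_diam_of_mem h.isCompact.isBounded ha hb))
  | succ N ih =>
    have key : ∀ i D, a ∈ g (i + 1) '' F → b ∈ g (i + 1) '' F →
        IsComponent (g (i + 1) '' F \ {a, b}) D → ncp (closure D) ≤ ((n - 2 : ℕ) : ℕ∞) := by
      intro i D hai hbi hD
      obtain ⟨a', ha', b', hb', D', rfl, rfl, -, hN', hD', -, hncp⟩ :=
        h.exists_pullback hai hbi hN hD
      rw [hncp]
      exact ih ha' hb' (fun h' => hab (h' ▸ rfl)) hD' hN'
    rcases h.isRing.component_cases hab hC with h1 | ⟨i, -, h1⟩ | ⟨i, hai, hbi, hC', -⟩ |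
      ⟨i, hai, hbi, D, hD, -, -, -, hcut⟩
    · exact h1.le
    · rw [h1, h.isRing.ncp_chain (by lia)]
      exact_mod_cast (by lia)
    · exact key i C hai hbi hC'
    · exact (encard_le_encard fun x hx => hcut x hx).trans (key i D hai hbi hD)

theorem eq_nodes_of_le_ncp (h : IsSelfSimilarRing n F g p c)
    (hgood : ∀ i j, ¬ (p i ∈ g (i + 1) '' (g j '' F) ∧ p (i + 1) ∈ g (i + 1) '' (g j '' F)))
    {a b : α} {C : Set α} (ha : a ∈ F) (hb : b ∈ F) (hab : a ≠ b)
    (hC : IsComponent (F \ {a, b}) C) (hncp : ((n - 2 : ℕ) : ℕ∞) ≤ ncp (closure C)) :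
    ∃ i, ({a, b} : Set α) = {p i, p (i + 1)} ∧
      closure C = chain (fun j => g j '' F) (i + 2) (i + n + 1) := by
  obtain ⟨N, hN⟩ := h.exists_pow_lt hab
  have hn := h.isRing.three_le
  induction N generalizing a b C with
  | zero =>
    rw [pow_zero, mul_one] at hN
    exact absurd hN (not_lt.2 (Metric.dist_le_diam_of_mem h.isCompact.isBounded ha hb))
  | succ N ih =>
    rcases h.isRing.component_cases hab hC with h1 | h1 | ⟨i, hai, hbi, hC', hu, hv⟩ |
      ⟨i, hai, hbi, D, hD, hu, hv, hcl, hcut⟩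
    · exact absurd hncp (not_le.2 h1)
    · exact h1
    · exfalso
      obtain ⟨a', ha', b', hb', D', rfl, rfl, -, hN', hD', hcl, hncp'⟩ :=
        h.exists_pullback hai hbi hN hC'
      rw [hncp'] at hncp
      obtain ⟨l, hl, hchain⟩ := ih ha' hb' (fun h' => hab (h' ▸ rfl)) hD' hncp hN'
      -- `closure C` fills every second-level piece but the one with index `l + 1`, and it exceeds
      -- `C` only in the two removed points, which are end nodes of that piece. Both nodes `p i`, `p
      -- (i + 1)` avoid `C`, so they share it, against goodness.
      have hmem : ∀ w ∈ g (i + 1) '' F, w ∉ C → w ∈ g (i + 1) '' (g (l + 1) '' F) := by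
        rintro _ ⟨w, hw, rfl⟩ hwC
        refine mem_image_of_mem _ ?_
        rw [← h.isRing.piece_union_chain l] at hw
        rcases hw with hw | hw
        · exact hw
        · rw [← hchain] at hw
          have h2 : g (i + 1) w ∈ closure C := hcl ▸ mem_image_of_mem _ hw
          have h3 := (hC'.closure_subset_union (h.isRing.isClosed _) h2).resolve_left hwC
          rw [← image_pair, (g (i + 1)).injective.mem_set_image, hl] at h3
          rcases h3 with rfl | rfl
          · exact h.isRing.node_mem_succ l
          · exact h.isRing.node_mem (l + 1)
      exact hgood i (l + 1) ⟨hmem _ (h.isRing.node_mem_succ i) hu,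
        hmem _ (h.isRing.node_mem (i + 1)) hv⟩
    · exfalso
      have hDncp : ((n - 2 : ℕ) : ℕ∞) ≤ ncp (closure D) :=
        hncp.trans (encard_le_encard fun x hx => hcut x hx)
      obtain ⟨a', ha', b', hb', D', rfl, rfl, -, hN', hD', hclD, hncp'⟩ :=
        h.exists_pullback hai hbi hN hD
      rw [hncp'] at hDncp
      obtain ⟨l, hl, hchain⟩ := ih ha' hb' (fun h' => hab (h' ▸ rfl)) hD' hDncp hN'
      rw [hchain] at hclD
      rw [hclD] at hu hv
      obtain ⟨u, huc, hgu⟩ := hu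
      obtain ⟨v, hvc, hgv⟩ := hv
      -- By goodness the end nodes of the piece share no second-level piece, so an inner node of the
      -- run lies between them.
      obtain ⟨j, hj1, hj2, huj, hvj, hsep⟩ := h.isRing.exists_node_between huc hvc
        fun j hj => hgood i j ⟨⟨u, hj.1, hgu⟩, ⟨v, hj.2, hgv⟩⟩
      have hxD : IsCutPoint (closure D) (g (i + 1) (p j)) := by
        rw [hclD, isCutPoint_image_iff (h.isRing.isPreconnected_chain _ _),
          h.isRing.isCutPoint_chain_iff (by lia)]
        exact ⟨j, hj1, hj2, rfl⟩
      have hlink := h.isRing.isLink_compl i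
      set Q := chain (fun j => g j '' F) (i + 2) (i + n + 1) with hQ
      have hxQ : g (i + 1) (p j) ∉ Q := by
        intro hx
        have hpF : p j ∈ F := h.isRing.iUnion_eq.subset (mem_iUnion.2 ⟨j, h.isRing.node_mem j⟩)
        have : g (i + 1) (p j) ∈ ({p i, p (i + 1)} : Set α) :=
          h.isRing.piece_inter_chain i ▸ ⟨mem_image_of_mem _ hpF, hx⟩
        rw [← hgu, ← hgv, ← image_pair, (g (i + 1)).injective.mem_set_image] at this
        rcases this with h' | h'
        · exact huj h'.symm
        · exact hvj h'.symm
      -- The halves on the two sides of this node contain one end of `Q` each, so `Q` reconnects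
      -- them when the node is removed.
      have hxC : ¬ IsCutPoint (closure C) (g (i + 1) (p j)) := by
        rintro ⟨-, hx, -⟩
        apply hx
        have hL := (h.isRing.isPreconnected_chain_diff_singleton (s := l + 2) (t := j + 1)
          (x := p j) fun k h3 h4 h5 => h.isRing.node_ne k j (by lia) (by lia) h5.symm).image
          (g (i + 1)) (g (i + 1)).continuous.continuousOn
        have hR := (h.isRing.isPreconnected_chain_diff_singleton (s := j + 1) (t := l + n + 1)
          (x := p j) fun k h3 h4 h5 => h.isRing.node_ne j k (by lia) (by lia) h5).image
          (g (i + 1)) (g (i + 1)).continuous.continuousOn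
        have heq : closure C \ {g (i + 1) (p j)} =
            g (i + 1) '' (chain (fun j => g j '' F) (l + 2) (j + 1) \ {p j}) ∪ Q ∪
              g (i + 1) '' (chain (fun j => g j '' F) (j + 1) (l + n + 1) \ {p j}) := by
          rw [hcl, hclD, ← chain_union_chain _ (t := j + 1) (by lia) (by lia), union_sdiff_distrib,
            sdiff_singleton_eq_self hxQ, ← image_singleton, ← image_sdiff (g (i + 1)).injective,
            union_sdiff_distrib, image_union, union_right_comm]
        rw [heq]
        have hgu' : g (i + 1) u ∈ Q := hgu ▸ hlink.left_mem
        have hgv' : g (i + 1) v ∈ Q := hgv ▸ hlink.right_mem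
        rcases hsep with ⟨h3, h4⟩ | ⟨h3, h4⟩
        · exact IsPreconnected.union' ⟨g (i + 1) v, Or.inr hgv', ⟨v, ⟨h4, hvj⟩, rfl⟩⟩
            (hL.union' ⟨g (i + 1) u, ⟨u, ⟨h3, huj⟩, rfl⟩, hgu'⟩ hlink.isPreconnected) hR
        · exact IsPreconnected.union' ⟨g (i + 1) u, Or.inr hgu', ⟨u, ⟨h4, huj⟩, rfl⟩⟩
            (hL.union' ⟨g (i + 1) v, ⟨v, ⟨h3, hvj⟩, rfl⟩, hgv'⟩ hlink.isPreconnected) hR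
      have hDle : ncp (closure D) ≤ ((n - 2 : ℕ) : ℕ∞) :=
        hncp' ▸ h.ncp_closure_le ha' hb' (fun h' => hab (h' ▸ rfl)) hD'
      -- Finiteness is what makes a proper inclusion of cut point sets a strict inequality in `ℕ∞`.
      have hfin : {x | IsCutPoint (closure C) x}.Finite :=
        finite_of_encard_le_coe ((encard_le_encard fun x hx => hcut x hx).trans hDle)
      have hlt : ncp (closure C) < ncp (closure D) := by
        refine hfin.encard_lt_encard ⟨fun x hx => hcut x hx, fun hsub => hxC (hsub hxD)⟩
      exact absurd hncp (not_le.2 (hlt.trans_le hDle))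

end IsSelfSimilarRing

end SelfSimilarRing

/-! ### From components to extremal cuts -/

section Extremal

variable {α : Type*} [TopologicalSpace α]

theorem mem_relFrontier {X A : Set α} {x : α} (hxX : x ∈ X) (hxA : x ∈ A)
    (hx : x ∈ closure (X \ A)) : x ∈ relFrontier X A := by
  refine ⟨⟨x, hxX⟩, ?_, rfl⟩
  rw [frontier_eq_closure_inter_closure]
  refine ⟨subset_closure hxA, ?_⟩
  rw [closure_subtype, ← preimage_compl, Subtype.image_preimage_coe]
  exact hx

theorem isKCut_two_pair {X : Set α} {a b : α} (hX : IsPreconnected X)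
    (hX' : ∀ x, IsPreconnected (X \ {x})) (ha : a ∈ X) (hb : b ∈ X) (hab : a ≠ b)
    (h : ¬ IsPreconnected (X \ {a, b})) : IsKCut 2 X {a, b} := by
  refine ⟨⟨?_, h, fun B hB => ?_⟩, encard_pair hab⟩
  · rintro x (rfl | rfl) <;> assumption
  · obtain ⟨x, hx⟩ : ∃ x, B ⊆ {x} := by
      by_cases haB : a ∈ B
      · refine ⟨a, fun y hy => (hB.1 hy).resolve_right ?_⟩
        rintro rfl
        exact hB.2 (by rintro w (rfl | rfl) <;> assumption)
      · refine ⟨b, fun y hy => (hB.1 hy).resolve_left ?_⟩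
        rintro rfl
        exact haB hy
    rcases subset_singleton_iff_eq.1 hx with rfl | rfl
    · simpa using hX
    · exact hX' x

theorem closure_component_inter {X A C : Set α} (hX : IsClosed X) (hC : IsComponent (X \ A) C) :
    closure C ∩ X = closure C :=
  inter_eq_left.2 (closure_minimal (hC.subset.trans sdiff_subset) hX)

namespace IsRing

variable {n : ℕ} {X : Set α} {K : ℕ → Set α} {p : ℕ → α}

theorem node_mem_total (h : IsRing n X K p) (i : ℕ) : p i ∈ X :=
  h.iUnion_eq.subset (mem_iUnion.2 ⟨i, h.node_mem i⟩)

theorem node_ne_succ (h : IsRing n X K p) (i : ℕ) : p i ≠ p (i + 1) :=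
  h.node_ne i (i + 1) (by lia) (by have := h.three_le; lia)

variable [T1Space α]

/-- The run opposite a piece meets that piece only in the two nodes and stays connected without
them. -/
theorem isComponent_chain_diff (h : IsRing n X K p) (i : ℕ) :
    IsComponent (X \ {p i, p (i + 1)}) (chain K (i + 2) (i + n + 1) \ {p i, p (i + 1)}) := by
  have hn := h.three_le
  have hlink := h.isLink_compl i
  obtain ⟨y, hy⟩ : (chain K (i + 2) (i + n + 1) \ {p i, p (i + 1)}).Nonempty := by
    rw [← closure_nonempty_iff, h.closure_chain_diff (by lia)]
    exact ⟨_, hlink.left_mem⟩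
  have hyX : y ∈ X := h.piece_union_chain i ▸ Or.inr hy.1
  have hC : IsComponent (X \ {p i, p (i + 1)}) (connectedComponentIn (X \ {p i, p (i + 1)}) y) :=
    ⟨y, ⟨hyX, hy.2⟩, rfl⟩
  have hyC := mem_connectedComponentIn (F := X \ {p i, p (i + 1)}) ⟨hyX, hy.2⟩
  have hC' := hC
  conv at hC' => enter [1, 1]; rw [← h.piece_union_chain i]
  rcases hC'.eq_or_of_inter_subset (h.isClosed _) hlink.isClosed (h.piece_inter_chain i).subset
    (hlink.isPreconnected_diff _ inter_subset_left) with h' | ⟨-, h'⟩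
  · rwa [h'] at hC
  · exact absurd hy.1 (disjoint_left.1 h' hyC)

theorem isKCut_nodes (h : IsRing n X K p) (i : ℕ) : IsKCut 2 X {p i, p (i + 1)} := by
  have hn := h.three_le
  refine isKCut_two_pair h.isPreconnected_total h.isPreconnected_total_diff (h.node_mem_total i)
    (h.node_mem_total (i + 1)) (h.node_ne_succ i) fun hpre => ?_
  have heq := (h.isComponent_chain_diff i).eq_of_isPreconnected hpre
  obtain ⟨y, hy, hyA⟩ : (K (i + 1) \ {p i, p (i + 1)}).Nonempty := by
    rw [← closure_nonempty_iff]
    exact ⟨p i, subset_closure_diff_finite (h.isPreconnected _) (h.nontrivial _) (by simp)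
      (h.node_mem_succ i)⟩
  have : y ∈ chain K (i + 2) (i + n + 1) \ {p i, p (i + 1)} :=
    heq ▸ ⟨h.iUnion_eq.subset (mem_iUnion.2 ⟨_, hy⟩), hyA⟩
  exact hyA ((h.piece_inter_chain i).subset ⟨hy, this.1⟩)

theorem le_cutNumber_nodes (h : IsRing n X K p) (i : ℕ) :
    ((n - 2 : ℕ) : ℕ∞) ≤ cutNumber {p i, p (i + 1)} X := by
  have hn := h.three_le
  have hC := h.isComponent_chain_diff i
  have hcl := closure_component_inter h.isClosed_total hC
  rw [h.closure_chain_diff (by lia)] at hcl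
  have hncp := h.ncp_chain (s := i + 2) (t := i + n + 1) (by lia)
  refine le_trans ?_ (le_iSup₂_of_le _ hC le_rfl)
  rw [h.closure_chain_diff (by lia), hcl, hncp]
  exact_mod_cast (by lia)

/-- A neighbouring piece without the common node lies outside `K (i + 1)`, and the node is not
isolated in it. This is how goodness reaches the nodes. -/
theorem nodes_mem_relFrontier (h : IsRing n X K p) (i : ℕ) :
    p i ∈ relFrontier X (K (i + 1)) ∧ p (i + 1) ∈ relFrontier X (K (i + 1)) := by
  have hn := h.three_le
  have hsub : ∀ j, K j ⊆ X := fun j => h.iUnion_eq ▸ subset_iUnion K j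
  have hleft : K i \ {p i} ⊆ X \ K (i + 1) := by
    refine fun x hx => ⟨hsub i hx.1, fun hx' => hx.2 ?_⟩
    rcases h.eq_node i (i + 1) x (by lia) (by lia) hx.1 hx' with ⟨-, h'⟩ | ⟨h', -⟩
    · exact h'
    · lia
  have hright : K (i + 2) \ {p (i + 1)} ⊆ X \ K (i + 1) := by
    refine fun x hx => ⟨hsub (i + 2) hx.1, fun hx' => hx.2 ?_⟩
    rcases h.eq_node (i + 1) (i + 2) x (by lia) (by lia) hx' hx.1 with ⟨-, h'⟩ | ⟨h', -⟩
    · exact h'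
    · lia
  exact ⟨mem_relFrontier (h.node_mem_total i) (h.node_mem_succ i) (closure_mono hleft
      (subset_closure_diff_finite (h.isPreconnected _) (h.nontrivial _) (finite_singleton _)
        (h.node_mem i))),
    mem_relFrontier (h.node_mem_total _) (h.node_mem _) (closure_mono hright
      (subset_closure_diff_finite (h.isPreconnected _) (h.nontrivial _) (finite_singleton _)
        (h.node_mem_succ (i + 1))))⟩

end IsRing

end Extremal

namespace IsSelfSimilarRing

variable {α : Type*} [MetricSpace α] {n : ℕ} {F : Set α} {g : ℕ → α ≃ₜ α} {p : ℕ → α} {c : ℝ}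

theorem cutNumber_le (h : IsSelfSimilarRing n F g p c) {A : Set α} (hA : IsKCut 2 F A) :
    cutNumber A F ≤ ((n - 2 : ℕ) : ℕ∞) := by
  obtain ⟨a, b, hab, rfl⟩ := encard_eq_two.1 hA.2
  refine iSup₂_le fun C hC => ?_
  rw [closure_component_inter h.isRing.isClosed_total hC]
  exact h.ncp_closure_le (hA.1.1 (by simp)) (hA.1.1 (by simp)) hab hC

theorem cutNumber_nodes (h : IsSelfSimilarRing n F g p c) (i : ℕ) :
    cutNumber {p i, p (i + 1)} F = ((n - 2 : ℕ) : ℕ∞) :=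
  (h.cutNumber_le (h.isRing.isKCut_nodes i)).antisymm (h.isRing.le_cutNumber_nodes i)

theorem maxCutNumber_eq (h : IsSelfSimilarRing n F g p c) :
    maxCutNumber 2 F = ((n - 2 : ℕ) : ℕ∞) := by
  refine le_antisymm (iSup₂_le fun A hA => h.cutNumber_le hA) ?_
  rw [← h.cutNumber_nodes 0]
  exact le_iSup₂_of_le _ (h.isRing.isKCut_nodes 0) le_rfl

theorem isExtremalKCut_nodes (h : IsSelfSimilarRing n F g p c) (i : ℕ) :
    IsExtremalKCut 2 F {p i, p (i + 1)} :=
  ⟨h.isRing.isKCut_nodes i, by rw [h.cutNumber_nodes, h.maxCutNumber_eq]⟩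

theorem eq_nodes_of_isExtremalKCut (h : IsSelfSimilarRing n F g p c)
    (hgood : ∀ i j, ¬ (p i ∈ g (i + 1) '' (g j '' F) ∧ p (i + 1) ∈ g (i + 1) '' (g j '' F)))
    {A : Set α} (hA : IsExtremalKCut 2 F A) : ∃ i, A = {p i, p (i + 1)} := by
  obtain ⟨hcut, hmax⟩ := hA
  have hn := h.isRing.three_le
  rw [h.maxCutNumber_eq] at hmax
  -- The supremum is attained: if all values were below `n - 2`, it would be at most `n - 3`, which
  -- is smaller since `n ≥ 3`.
  have hex : ∃ C, IsComponent (F \ A) C ∧ ((n - 2 : ℕ) : ℕ∞) ≤ ncp (closure C) := by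
    by_contra! hlt
    have : cutNumber A F ≤ ((n - 3 : ℕ) : ℕ∞) := by
      refine iSup₂_le fun C hC => ?_
      rw [closure_component_inter h.isRing.isClosed_total hC]
      refine ENat.lt_natCast_add_one_iff.1 ?_
      have := hlt C hC
      rwa [show n - 2 = n - 3 + 1 by lia, Nat.cast_add, Nat.cast_one] at this
    rw [hmax] at this
    have : n - 2 ≤ n - 3 := by exact_mod_cast this
    lia
  obtain ⟨C, hC, hncp⟩ := hex
  obtain ⟨a, b, hab, rfl⟩ := encard_eq_two.1 hcut.2
  obtain ⟨i, hi, -⟩ := h.eq_nodes_of_le_ncp hgood (hcut.1.1 (by simp)) (hcut.1.1 (by simp)) hab hC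
    hncp
  exact ⟨i, hi⟩

end IsSelfSimilarRing

/-! ### Necklaces without cut points are self-similar rings -/

section Necklace

variable {α : Type*} [MetricSpace α] {n : ℕ} {f : Fin n → α ≃ₜ α} {F : Set α} {z : Fin n → α}

/-- The residue of a natural number as an index. -/
def residue (hn : 0 < n) (j : ℕ) : Fin n := ⟨j % n, Nat.mod_lt j hn⟩

theorem residue_val (hn : 0 < n) (k : Fin n) : residue hn k = k :=
  Fin.ext (Nat.mod_eq_of_lt k.isLt)

theorem residue_add_self (hn : 0 < n) (j : ℕ) : residue hn (j + n) = residue hn j :=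
  Fin.ext (Nat.add_mod_right j n)

theorem finRotate_residue (hn : 0 < n) (j : ℕ) :
    finRotate n (residue hn j) = residue hn (j + 1) := by
  have : NeZero n := ⟨hn.ne'⟩
  rw [finRotate_apply]
  ext
  simp [residue, Fin.val_add]

theorem IsNecklace.exists_contraction_ratio (hF : IsNecklace f F) :
    ∃ c : ℝ, 0 < c ∧ c < 1 ∧ ∀ k x y, dist (f k x) (f k y) ≤ c * dist x y := by
  choose c hc using hF.contracting
  -- The term `2⁻¹` makes the common ratio positive.
  refine ⟨((Finset.univ.sup c ⊔ 2⁻¹ : NNReal) : ℝ), ?_, ?_, fun k x y => ?_⟩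
  · have : (0 : NNReal) < Finset.univ.sup c ⊔ 2⁻¹ := lt_sup_of_lt_right (by positivity)
    exact_mod_cast this
  · have : Finset.univ.sup c ⊔ 2⁻¹ < (1 : NNReal) := by
      refine max_lt ((Finset.sup_lt_iff (by simp)).2 fun k _ => (hc k).1) ?_
      exact inv_lt_one_of_one_lt₀ (by norm_num)
    exact_mod_cast this
  · refine ((hc k).2.dist_le_mul x y).trans (mul_le_mul_of_nonneg_right ?_ dist_nonneg)
    have : c k ≤ Finset.univ.sup c ⊔ 2⁻¹ := le_sup_of_le_left (Finset.le_sup (Finset.mem_univ k))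
    exact_mod_cast this

theorem IsNecklace.eq_node (hF : IsNecklace f F) (hz : IsMainNodes f F z) (hn : 0 < n)
    {i j : ℕ} {x : α} (hij : i < j) (hj : j < i + n) (hxi : x ∈ f (residue hn i) '' F)
    (hxj : x ∈ f (residue hn j) '' F) :
    (j = i + 1 ∧ x = z (residue hn i)) ∨ (j + 1 = i + n ∧ x = z (residue hn j)) := by
  by_cases h1 : j = i + 1
  · refine Or.inl ⟨h1, (hz (residue hn i)).subset ⟨hxi, ?_⟩⟩
    rwa [finRotate_residue, ← h1]
  by_cases h2 : j + 1 = i + n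
  · refine Or.inr ⟨h2, (hz (residue hn j)).subset ⟨hxj, ?_⟩⟩
    rwa [finRotate_residue, h2, residue_add_self]
  exfalso
  have hi' := Nat.mod_lt i hn
  -- The residues differ by `j - i` or `n - (j - i)`, both between `2` and `n - 2` here, so the
  -- pieces are disjoint.
  have hj' : j % n = i % n + (j - i) ∨ j % n + n = i % n + (j - i) := by
    have hmod : j % n = (i % n + (j - i)) % n := by
      rw [Nat.mod_add_mod]
      congr 1
      lia
    rcases lt_or_ge (i % n + (j - i)) n with h | h
    · left
      rw [hmod, Nat.mod_eq_of_lt h]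
    · right
      rw [hmod, Nat.mod_eq_sub_mod h, Nat.mod_eq_of_lt (by lia)]
      lia
  have habs : |((residue hn i : Fin n) : ℤ) - ((residue hn j : Fin n) : ℤ)| = (j : ℤ) - i ∨
      |((residue hn i : Fin n) : ℤ) - ((residue hn j : Fin n) : ℤ)| = n - ((j : ℤ) - i) := by
    simp only [residue]
    rcases hj' with h | h
    · left
      rw [abs_of_nonpos (by lia)]
      lia
    · right
      rw [abs_of_nonneg (by lia)]
      lia
  have := hF.inter_empty (residue hn i) (residue hn j) (by lia) (by lia)
  exact (this.subset ⟨hxi, hxj⟩ : x ∈ (∅ : Set α))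

/-- A necklace without cut points is a self-similar ring. -/
theorem IsNecklace.isSelfSimilarRing (hF : IsNecklace f F) (hnt : F.Nontrivial)
    (hz : IsMainNodes f F z) (hcut : ∀ x, ¬ IsCutPoint F x) (hn : 0 < n) :
    ∃ c, IsSelfSimilarRing n F (fun j => f (residue hn j)) (fun j => z (residue hn j)) c := by
  obtain ⟨c, hc0, hc1, hc⟩ := hF.exists_contraction_ratio
  obtain ⟨-, hcomp, hun⟩ := hF.attractor
  have h3 := hF.three_le
  have hmem : ∀ j, z (residue hn j) ∈ f (residue hn j) '' F := fun j =>
    ((hz (residue hn j)).symm.subset rfl).1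
  have hmem' : ∀ j, z (residue hn j) ∈ f (residue hn (j + 1)) '' F := fun j => by
    rw [← finRotate_residue]
    exact ((hz (residue hn j)).symm.subset rfl).2
  have hunIio : ⋃ j ∈ Iio n, f (residue hn j) '' F = F := by
    conv_rhs => rw [hun]
    refine Subset.antisymm (iUnion₂_subset fun j _ => subset_iUnion (fun k => f k '' F) _)
      (iUnion_subset fun k => ?_)
    have := subset_biUnion_of_mem (u := fun j : ℕ => f (residue hn j) '' F) (mem_Iio.2 k.isLt)
    simpa only [residue_val] using this
  have hunN : ⋃ j, f (residue hn j) '' F = F :=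
    Subset.antisymm (iUnion_subset fun j => (subset_iUnion (fun k => f k '' F) _).trans hun.symm.subset)
      (hunIio.symm.subset.trans (iUnion₂_subset fun j _ =>
        subset_iUnion (fun j => f (residue hn j) '' F) j))
  have hFc : IsPreconnected F := isPreconnected_of_selfSimilar (g := fun j => f (residue hn j))
    hcomp hunN hc0 hc1 (fun j => hc _) fun j => ⟨_, hmem j, hmem' j⟩
  have hFo : HasOpenComponents F := hasOpenComponents_of_selfSimilar
    (g := fun j => f (residue hn j)) hcomp hunIio hFc hc0 hc1 (fun j => hc _)
  have hFd : ∀ x, IsPreconnected (F \ {x}) := by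
    intro x
    by_cases hx : x ∈ F
    · by_contra hcon
      exact hcut x ((isCutPoint_iff hFc).2 ⟨hx, hcon⟩)
    · rwa [sdiff_singleton_eq_self hx]
  have hcl : ∀ k, IsClosed (f k '' F) := fun k => (f k).isClosedMap F hcomp.isClosed
  have hne : ∀ i j, i < j → j < i + n → z (residue hn i) ≠ z (residue hn j) := by
    -- Only for `n = 3` could nodes coincide. A point common to all three pieces would be the only
    -- contact of one piece with the other two, hence a cut point of `F`.
    have hthree : ∀ i x, n = 3 → x ∈ f (residue hn i) '' F → x ∈ f (residue hn (i + 1)) '' F →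
        x ∈ f (residue hn (i + 2)) '' F → False := by
      intro i x hn3 h0 h1 h2
      have hcover : F ⊆ f (residue hn i) '' F ∪
          (f (residue hn (i + 1)) '' F ∪ f (residue hn (i + 2)) '' F) := by
        intro y hy
        obtain ⟨k, hk⟩ := mem_iUnion.1 (hun.subset hy)
        have hres : k = residue hn i ∨ k = residue hn (i + 1) ∨ k = residue hn (i + 2) := by
          have hk3 := k.isLt
          simp only [Fin.ext_iff, residue]
          subst hn3
          lia
        rcases hres with rfl | rfl | rfl
        exacts [Or.inl hk, Or.inr (Or.inl hk), Or.inr (Or.inr hk)]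
      have hsub : ∀ k, f k '' F ⊆ F := fun k =>
        (subset_iUnion (fun k => f k '' F) k).trans hun.symm.subset
      obtain ⟨y, hy, hyx⟩ := (hnt.image (f (residue hn i)).injective).exists_ne x
      obtain ⟨w, hw, hwx⟩ := (hnt.image (f (residue hn (i + 1))).injective).exists_ne x
      obtain ⟨q, ⟨-, hqx⟩, hq0, hq⟩ := isPreconnected_closed_iff.1 (hFd x) _ _ (hcl _)
        ((hcl _).union (hcl _)) (sdiff_subset.trans hcover) ⟨y, ⟨hsub _ hy, hyx⟩, hy⟩
        ⟨w, ⟨hsub _ hw, hwx⟩, Or.inl hw⟩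
      apply hqx
      rcases hq with hq | hq
      · rcases hF.eq_node hz hn (i := i) (j := i + 1) (by lia) (by lia) h0 h1 with ⟨-, h⟩ | ⟨h, -⟩
        · rcases hF.eq_node hz hn (i := i) (j := i + 1) (by lia) (by lia) hq0 hq with
            ⟨-, h'⟩ | ⟨h', -⟩
          · exact h'.trans h.symm
          · lia
        · lia
      · rcases hF.eq_node hz hn (i := i) (j := i + 2) (by lia) (by lia) h0 h2 with ⟨h, -⟩ | ⟨-, h⟩
        · lia
        · rcases hF.eq_node hz hn (i := i) (j := i + 2) (by lia) (by lia) hq0 hq with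
            ⟨h', -⟩ | ⟨-, h'⟩
          · lia
          · exact h'.trans h.symm
    intro i j hij hj heq
    rcases hF.eq_node hz hn hij hj (hmem i) (heq ▸ hmem j) with ⟨rfl, -⟩ | ⟨h, -⟩
    · have h2 : z (residue hn i) ∈ f (residue hn (i + 2)) '' F := heq ▸ hmem' (i + 1)
      rcases hF.eq_node hz hn (i := i) (j := i + 2) (by lia) (by lia) (hmem i) h2 with
        ⟨h', -⟩ | ⟨h', -⟩
      · lia
      · exact hthree i _ (by lia) (hmem i) (hmem' i) h2
    · rcases hF.eq_node hz hn (i := i + 1) (j := j) (by lia) (by lia) (hmem' i) (heq ▸ hmem j) with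
        ⟨h', -⟩ | ⟨h', -⟩
      · obtain rfl : j = i + 2 := by lia
        exact hthree i _ (by lia) (hmem i) (hmem' i) (heq ▸ hmem _)
      · lia
  refine ⟨c, ⟨⟨h3, fun j => ?_, fun j => ?_, hunN, hmem, hmem', fun i j x => hF.eq_node hz hn, hne,
    fun j => hcl _, fun j => hnt.image (f _).injective, fun j => (f _).isPreconnected_image.2 hFc,
    fun j x => ?_, fun j => hFo.image _⟩, hcomp, hc0, hc1, fun j => hc _⟩⟩
  · simp only [residue_add_self]
  · simp only [residue_add_self]
  · obtain ⟨y, rfl⟩ := (f (residue hn j)).surjective x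
    rw [← image_singleton, ← image_sdiff (f _).injective]
    exact (f _).isPreconnected_image.2 (hFd y)

end Necklace

end Necklace

theorem mainTheorem4 {d n : ℕ}
    (f : Fin n → EuclideanSpace ℝ (Fin d) ≃ₜ EuclideanSpace ℝ (Fin d))
    (F : Set (EuclideanSpace ℝ (Fin d))) (hF : Necklace.IsNecklace f F)
    (hnt : F.Nontrivial)
    (z : Fin n → EuclideanSpace ℝ (Fin d)) (hz : Necklace.IsMainNodes f F z)
    (hcut : ∀ x, ¬ Necklace.IsCutPoint F x) :
    Necklace.maxCutNumber 2 F = ((n - 2 : ℕ) : ℕ∞) ∧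
    (∀ k, Necklace.IsExtremalKCut 2 F {z ((finRotate n).symm k), z k}) ∧
    (Necklace.IsGood f F →
      ∀ A, Necklace.IsExtremalKCut 2 F A ↔ ∃ k, A = {z ((finRotate n).symm k), z k}) := by
  have hn : 0 < n := by have := hF.three_le; lia
  obtain ⟨c, h⟩ := hF.isSelfSimilarRing hnt hz hcut hn
  have hext : ∀ k, Necklace.IsExtremalKCut 2 F {z ((finRotate n).symm k), z k} := by
    intro k
    obtain ⟨l, rfl⟩ := (finRotate n).surjective k
    have := h.isExtremalKCut_nodes l
    simp only [← Necklace.finRotate_residue, Necklace.residue_val] at this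
    rwa [Equiv.symm_apply_apply]
  refine ⟨h.maxCutNumber_eq, hext, fun hgood A => ⟨fun hA => ?_, ?_⟩⟩
  -- Both nodes of a piece are relative boundary points, so goodness forbids them a common
  -- second-level piece.
  · obtain ⟨i, rfl⟩ := h.eq_nodes_of_isExtremalKCut (fun i j hij => by
      have hfr := h.isRing.nodes_mem_relFrontier i
      exact h.isRing.node_ne_succ i (encard_le_one_iff.1 (hgood _ _) _ _ ⟨hij.1, hfr.1⟩
        ⟨hij.2, hfr.2⟩)) hA
    exact ⟨finRotate n (Necklace.residue hn i), by
      rw [Equiv.symm_apply_apply, Necklace.finRotate_residue]⟩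
  · rintro ⟨k, rfl⟩
    exact hext k
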